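/- **Setting.** Let $f:\mathbb R^N\to\mathbb R$ and $c:\mathbb R^N\to\mathbb R^M$ be twice continuously differentiable, $g=\nabla f$, $J$ the Jacobian of $c$, $v(x)=\tfrac12\|c(x)\|^2$, $g^v=\nabla v=J^Tc$, $H^v=\nabla^2 v$; norms are Euclidean (spectral for matrices), and a subscript $k$ denotes evaluation at $x_k$. Write $m^v_k(s)=v_k+(g^v_k)^Ts+\tfrac12 s^TH^v_ks$ and $m^f_k(s)=f_k+g_k^Ts+\tfrac12 s^TH_ks$, where $H_k$ is symmetric. The parameters are $\kappa_n,\kappa_{vm},\kappa_{ntn},\kappa_\rho,\kappa_{fm},\kappa_{st},\kappa_{ntt},\kappa_{v1},\kappa_{v2},\gamma_c\in(0,1)$, $\kappa_p,\kappa_{ht},\kappa_{hs},\epsilon,\underline\sigma\in(0,\infty)$, $\kappa_\delta,\gamma_e,\gamma_\lambda\in(1,\infty)$, $\overline\sigma\in[\underline\sigma,\infty)$. **Algorithm (trust funnel, phase 1).** Choose $x_0$, $v^{\max}_0\ge\max\{1,v_0\}$, $\sigma^v_0\in[\underline\sigma,\overline\sigma]$, $\delta^v_0,\Delta^v_0,\delta^f_0>0$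 with $\delta^v_0\le\Delta^v_0$. For $k=0,1,2,\dots$: stop if $\|g^v_k\|\le\epsilon$; otherwise do the following. 1. *Steps.* Let $(n_k,\lambda^v_k)$ be a primal-dual solution of $\min\{m^v_k(n):\|n\|\le\delta^v_k\}$, i.e. $n_k$ is a global minimizer, $g^v_k+(H^v_k+\lambda^v_kI)n_k=0$, $H^v_k+\lambda^v_kI\succeq0$, $\lambda^v_k\ge0$, $\lambda^v_k(\delta^v_k-\|n_k\|)=0$. Let $\delta^s_k=\min\{\kappa_\delta\delta^v_k,\delta^f_k\}$. If $\|n_k\|\le\kappa_n\delta^s_k$ and $\|P_k(g_k+H_kn_k)\|\ge\kappa_p\|g^v_k\|$, where $P_k$ is the orthogonal projector onto $\mathrm{Null}(J_k)$, let $(t_k,\lambda^f_k)$ be part of a primal-dual solution of $\min\{m^f_k(n_k+t):J_kt=0,\ \|n_k+t\|\le\delta^s_k\}$, i.e. $t_k$ is a global minimizer and, for some $y$, $(H_k+\lambda^f_kI)t_k+J_k^Ty=-(g_k+(H_k+\lambda^f_kI)n_k)$, $H_k+\lambda^f_kI$ is positive semidefinite on $\mathrm{Null}(J_k)$, $\lambda^f_k\ge0$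 and $\lambda^f_k(\delta^s_k-\|n_k+t_k\|)=0$; reset $(t_k,\lambda^f_k)=(0,0)$ unless $m^v_k(0)-m^v_k(n_k+t_k)\ge\kappa_{vm}(m^v_k(0)-m^v_k(n_k))$, $\|n_k+t_k\|\ge\kappa_{ntn}\|n_k\|$ and $\|H^v_kt_k\|\le\kappa_{ht}\|n_k+t_k\|^2$. In all other cases $(t_k,\lambda^f_k)=(0,0)$. Put $s_k=n_k+t_k$. As long as $(x_k,\delta^v_k)$ is unchanged from one iteration to the next, so are $(n_k,\lambda^v_k)$ and $H_k$. 2. *Update of $\sigma^v$* ($k\ge1$). If iteration $k-1$ was a V-iteration with $\rho^v_{k-1}<\kappa_\rho$, then $\sigma^v_k=\max\{\sigma^v_{k-1},\lambda^v_k/\|n_k\|\}$; otherwise $\sigma^v_k=\sigma^v_{k-1}$. 3. *Type.* Iteration $k$ is an F-iteration if $t_k\ne0$, $\|t_k\|\ge\kappa_{st}\|s_k\|$, $m^f_k(0)-m^f_k(s_k)\ge\kappa_{fm}(m^f_k(n_k)-m^f_k(s_k))$, $v(x_k+s_k)\le v^{\max}_k-\kappa_\rho\|s_k\|^3$, $n_k^Tt_k\ge-\tfrac12\kappa_{ntt}\|t_k\|^2$,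 $\lambda^v_k\le\sigma^v_k\|n_k\|$ and $\|(H_k-\nabla^2f(x_k))s_k\|\le\kappa_{hs}\|s_k\|^2$; otherwise it is a V-iteration. 4. *F-iteration.* $\rho^f_k=(f_k-f(x_k+s_k))/\|s_k\|^3$, $(\delta^v_{k+1},\Delta^v_{k+1})=(\delta^v_k,\Delta^v_k)$. If $\rho^f_k\ge\kappa_\rho$: $x_{k+1}=x_k+s_k$, $v^{\max}_{k+1}=\min\{\max\{\kappa_{v1}v^{\max}_k,v^{\max}_k-\kappa_\rho\|s_k\|^3\},\,v_{k+1}+\kappa_{v2}(v^{\max}_k-v_{k+1})\}$, $\delta^f_{k+1}=\max\{\delta^f_k,\gamma_e\|s_k\|\}$. Otherwise $x_{k+1}=x_k$, $v^{\max}_{k+1}=v^{\max}_k$, and: if $\lambda^f_k<\underline\sigma\|s_k\|$, then $\delta^f_{k+1}=\|n_k+t\|$, where $\lambda>\lambda^f_k$ and $t$ solves $\min\{(g_k+(H_k+\lambda I)n_k)^Tt+\tfrac12t^T(H_k+\lambda I)t: J_kt=0\}$ with $\underline\sigma\le\lambda/\|n_k+t\|$; else $\delta^f_{k+1}=\gamma_c\|s_k\|$.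 5. *V-iteration.* $\rho^v_k=(v_k-v(x_k+s_k))/\|s_k\|^3$, $\delta^f_{k+1}=\delta^f_k$. If $\rho^v_k\ge\kappa_\rho$ and ($\lambda^v_k\le\sigma^v_k\|n_k\|$ or $\|n_k\|=\Delta^v_k$): $x_{k+1}=x_k+s_k$, $v^{\max}_{k+1}=\min\{\max\{\kappa_{v1}v^{\max}_k,v_{k+1}+\kappa_{v2}(v_k-v_{k+1})\},\,v_{k+1}+\kappa_{v2}(v^{\max}_k-v_{k+1})\}$, $\Delta^v_{k+1}=\max\{\Delta^v_k,\gamma_e\|n_k\|\}$, $\delta^v_{k+1}=\min\{\Delta^v_{k+1},\max\{\delta^v_k,\gamma_e\|n_k\|\}\}$. Otherwise $(x,v^{\max},\Delta^v)_{k+1}=(x,v^{\max},\Delta^v)_k$; if moreover $\rho^v_k\ge\kappa_\rho$, then $\delta^v_{k+1}=\min\{\Delta^v_{k+1},\lambda^v_k/\sigma^v_k\}$; and if $\rho^v_k<\kappa_\rho$, then with $n(\lambda)$ the minimizer of $v_k+(g^v_k)^Tn+\tfrac12n^T(H^v_k+\lambda I)n$: (a) if $\lambda^v_k<\underline\sigma\|n_k\|$,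 let $\hat\lambda=\lambda^v_k+(\underline\sigma\|g^v_k\|)^{1/2}$; if $\hat\lambda/\|n(\hat\lambda)\|\le\overline\sigma$ then $\delta^v_{k+1}=\|n(\hat\lambda)\|$, else $\delta^v_{k+1}=\|n(\lambda)\|$ for some $\lambda\in(\lambda^v_k,\hat\lambda)$ with $\underline\sigma\le\lambda/\|n(\lambda)\|\le\overline\sigma$; (b) if $\lambda^v_k\ge\underline\sigma\|n_k\|$, then $\delta^v_{k+1}=\max\{\|n(\gamma_\lambda\lambda^v_k)\|,\gamma_c\|n_k\|\}$. **Assumptions.** The iterates lie in a compact set and $\{\|H_k\|\}$ is bounded; $H^v$ and $\nabla^2f$ are Lipschitz continuous with constants $H^v_{Lip},H_{Lip}\in(0,\infty)$ on the segments $[x_k,x_k+s_k]$; and, for a constant $\zeta_{\min}\in(0,\infty)$, every Jacobian $J_k$ has full row rank with singular values bounded below by $\zeta_{\min}$. Let $\mathcal I=\{k:\|g^v_k\|>\epsilon\}$ and $\mathcal I_c=\{k:\|c_k\|>\epsilon/\zeta_{\min}\}$, where $k$ ranges over the indices of the iterates generated up to termination. **Statement.** Fix $f$, $c$, all parameters other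 than $\epsilon$, the initial values $v^{\max}_0,\Delta^v_0$, and $H^v_{Lip},H_{Lip},\zeta_{\min}$. (i) There is $\sigma^v_{\max}\in(0,\infty)$, independent of $\epsilon$, such that $\sigma^v_0\le\sigma^v_{\max}$ and $\sigma^v_k\le\sigma^v_{\max}$ for all $k\in\mathcal I$, in every run of the algorithm, with any tolerance $\epsilon\in(0,\infty)$, that satisfies the assumptions. (ii) For every $\epsilon\in(0,\infty)$, every such run with tolerance $\epsilon$ and every $\sigma^v_{\max}$ such that $\sigma^v_0\le\sigma^v_{\max}$ and $\sigma^v_k\le\sigma^v_{\max}$ for all $k\in\mathcal I$ in this run, $\mathcal I_c$ is finite and $|\mathcal I_c|\le K(\epsilon)$, where $$K(\epsilon)=\bigl(K_\sigma(\epsilon)+K^v_\Delta+1\bigr)\bigl(K^v_{\mathcal C}+2\bigr)\bigl(K^f_{\mathcal C}+1\bigr),$$ $$K_\sigma(\epsilon)=\left\lfloor\frac{v^{\max}_0\,\epsilon^{-3/2}}{\kappa_\rho(1-\kappa_{v2})\bigl(H^v_{Lip}+\kappa_{ht}+\sigma^v_{\max}/\kappa_{ntn}^2\bigr)^{-3/2}}\right\rfloor,\qquad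 K^v_\Delta=\left\lfloor\frac{v^{\max}_0}{\kappa_\rho\kappa_{ntn}^3(1-\kappa_{v2})(\Delta^v_0)^3}\right\rfloor,$$ $$K^v_{\mathcal C}=1+\left\lfloor\frac{\log(\sigma^v_{\max}/\underline\sigma)}{\log(\min\{\gamma_\lambda,\gamma_c^{-1}\})}\right\rfloor,\qquad K^f_{\mathcal C}=\max\left\{1,\,2+\left\lfloor\frac{1}{\log(\gamma_c^{-1})}\log\left(\frac{\kappa_{hs}+H_{Lip}+2\kappa_\rho}{\underline\sigma\,\kappa_{fm}\kappa_{st}^2(1-\kappa_{ntt})}\right)\right\rfloor\right\}.$$ (iii) Consequently, for every $\bar\epsilon\in(0,\infty)$ there is $C\in(0,\infty)$ such that $\mathcal I_c$ is finite and $|\mathcal I_c|\le C\,\epsilon^{-3/2}$ for all $\epsilon\in(0,\bar\epsilon)$ and all runs with tolerance $\epsilon$ that satisfy the assumptions. -/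

import Mathlib

open scoped InnerProductSpace
open Set

noncomputable section

namespace TrustFunnel

/-- `ℝ^n` with the Euclidean inner product and norm. -/
abbrev Vec (n : ℕ) : Type := EuclideanSpace ℝ (Fin n)

/-- The Hessian of a real function, as the linear operator `D(∇φ)(x)`. -/
def hessian {N : ℕ} (φ : Vec N → ℝ) (x : Vec N) : Vec N →L[ℝ] Vec N :=
  fderiv ℝ (gradient φ) x

/-- The Jacobian `J(x)` of the constraint function. -/
def jac {N M : ℕ} (c : Vec N → Vec M) (x : Vec N) : Vec N →L[ℝ] Vec M :=
  fderiv ℝ c x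

/-- The infeasibility measure `v(x) = ½‖c(x)‖²`. -/
def infeas {N M : ℕ} (c : Vec N → Vec M) (x : Vec N) : ℝ :=
  1 / 2 * ‖c x‖ ^ 2

/-- `gᵛ(x) = ∇v(x)`, which equals `J(x)ᵀ c(x)`. -/
def gv {N M : ℕ} (c : Vec N → Vec M) (x : Vec N) : Vec N :=
  gradient (infeas c) x

/-- `Hᵛ(x) = ∇²v(x)`. -/
def Hv {N M : ℕ} (c : Vec N → Vec M) (x : Vec N) : Vec N →L[ℝ] Vec N :=
  hessian (infeas c) x

/-- The second-order model of `v` at `x`. -/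
def mv {N M : ℕ} (c : Vec N → Vec M) (x n : Vec N) : ℝ :=
  infeas c x + ⟪gv c x, n⟫_ℝ + 1 / 2 * ⟪n, Hv c x n⟫_ℝ

/-- The quadratic model of `f` at `x` with the symmetric matrix `H`. -/
def mf {N : ℕ} (f : Vec N → ℝ) (x : Vec N) (H : Vec N →L[ℝ] Vec N) (s : Vec N) : ℝ :=
  f x + ⟪gradient f x, s⟫_ℝ + 1 / 2 * ⟪s, H s⟫_ℝ

/-- `(n, lam)` is a primal-dual solution of `min mv(n)` subject to `‖n‖ ≤ δ`. -/
structure IsNormalStep {N M : ℕ} (c : Vec N → Vec M) (x : Vec N) (δ : ℝ)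
    (n : Vec N) (lam : ℝ) : Prop where
  feasible : ‖n‖ ≤ δ
  minimal : ∀ n' : Vec N, ‖n'‖ ≤ δ → mv c x n ≤ mv c x n'
  dual : gv c x + (Hv c x n + lam • n) = 0
  psd : ∀ w : Vec N, 0 ≤ ⟪w, Hv c x w + lam • w⟫_ℝ
  lam_nonneg : 0 ≤ lam
  comp : lam * (δ - ‖n‖) = 0

/-- `n` solves the regularized normal subproblem
`min v + gᵛᵀn + ½ nᵀ(Hᵛ + lam I)n`. -/
def SolvesQv {N M : ℕ} (c : Vec N → Vec M) (x : Vec N) (lam : ℝ) (n : Vec N) : Prop :=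
  ∀ n' : Vec N,
    infeas c x + ⟪gv c x, n⟫_ℝ + 1 / 2 * ⟪n, Hv c x n + lam • n⟫_ℝ ≤
      infeas c x + ⟪gv c x, n'⟫_ℝ + 1 / 2 * ⟪n', Hv c x n' + lam • n'⟫_ℝ

/-- `(t, lam)` is part of a primal-dual solution `(t, y, lam)` of `min mf(n + t)` subject to
`J t = 0` and `‖n + t‖ ≤ δ`. -/
structure IsTangentialStep {N M : ℕ} (f : Vec N → ℝ) (c : Vec N → Vec M) (x : Vec N)
    (H : Vec N →L[ℝ] Vec N) (n : Vec N) (δ : ℝ) (t : Vec N) (lam : ℝ) : Prop where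
  null : jac c x t = 0
  feasible : ‖n + t‖ ≤ δ
  minimal : ∀ t' : Vec N, jac c x t' = 0 → ‖n + t'‖ ≤ δ → mf f x H (n + t) ≤ mf f x H (n + t')
  dual : ∃ y : Vec M, H t + lam • t + (ContinuousLinearMap.adjoint (jac c x)) y =
    -(gradient f x + (H n + lam • n))
  psd : ∀ w : Vec N, jac c x w = 0 → 0 ≤ ⟪w, H w + lam • w⟫_ℝ
  lam_nonneg : 0 ≤ lam
  comp : lam * (δ - ‖n + t‖) = 0

/-- `t` solves the regularized tangential subproblem
`min (g + (H + lam I)n)ᵀt + ½ tᵀ(H + lam I)t` subject to `J t = 0`. -/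
def SolvesQf {N M : ℕ} (f : Vec N → ℝ) (c : Vec N → Vec M) (x : Vec N)
    (H : Vec N →L[ℝ] Vec N) (n : Vec N) (lam : ℝ) (t : Vec N) : Prop :=
  jac c x t = 0 ∧ ∀ t' : Vec N, jac c x t' = 0 →
    ⟪gradient f x + (H n + lam • n), t⟫_ℝ + 1 / 2 * ⟪t, H t + lam • t⟫_ℝ ≤
      ⟪gradient f x + (H n + lam • n), t'⟫_ℝ + 1 / 2 * ⟪t', H t' + lam • t'⟫_ℝ

/-- `gᵖ = Z Zᵀ(g + H n)`, where the columns of `Z` are an orthonormal basis of `Null(J)`: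
the orthogonal projection of `g + H n` onto `Null(J)`. -/
def gp {N M : ℕ} (f : Vec N → ℝ) (c : Vec N → Vec M) (x : Vec N)
    (H : Vec N →L[ℝ] Vec N) (n : Vec N) : Vec N :=
  (LinearMap.ker (jac c x).toLinearMap).starProjection (gradient f x + H n)

/-- The input parameters of the algorithm, other than the tolerance `ε`, with their ranges. -/
structure Params where
  (κn κvm κntn κρ κfm κst κntt κv1 κv2 γc : ℝ)
  (κp κht κhs σlo : ℝ)
  (κδ γe γl : ℝ)
  σhi : ℝ
  κn_mem : κn ∈ Ioo (0 : ℝ) 1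
  κvm_mem : κvm ∈ Ioo (0 : ℝ) 1
  κntn_mem : κntn ∈ Ioo (0 : ℝ) 1
  κρ_mem : κρ ∈ Ioo (0 : ℝ) 1
  κfm_mem : κfm ∈ Ioo (0 : ℝ) 1
  κst_mem : κst ∈ Ioo (0 : ℝ) 1
  κntt_mem : κntt ∈ Ioo (0 : ℝ) 1
  κv1_mem : κv1 ∈ Ioo (0 : ℝ) 1
  κv2_mem : κv2 ∈ Ioo (0 : ℝ) 1
  γc_mem : γc ∈ Ioo (0 : ℝ) 1
  κp_pos : 0 < κp
  κht_pos : 0 < κht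
  κhs_pos : 0 < κhs
  σlo_pos : 0 < σlo
  one_lt_κδ : 1 < κδ
  one_lt_γe : 1 < γe
  one_lt_γl : 1 < γl
  σlo_le_σhi : σlo ≤ σhi

/-- The quantities generated by the algorithm, indexed by the iteration number. -/
structure Iterates (N : ℕ) where
  x : ℕ → Vec N
  vmax : ℕ → ℝ
  σv : ℕ → ℝ
  δv : ℕ → ℝ
  Δv : ℕ → ℝ
  δf : ℕ → ℝ
  H : ℕ → (Vec N →L[ℝ] Vec N)
  n : ℕ → Vec N
  t : ℕ → Vec N
  lamv : ℕ → ℝ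
  lamf : ℕ → ℝ

namespace Iterates

variable {N : ℕ} (r : Iterates N)

/-- The full step `s_k = n_k + t_k`. -/
def s (k : ℕ) : Vec N := r.n k + r.t k

/-- The radius `δˢ_k = min{κ_δ δᵛ_k, δᶠ_k}`. -/
def δs (P : Params) (k : ℕ) : ℝ := min (P.κδ * r.δv k) (r.δf k)

end Iterates

section Algorithm

variable {N M : ℕ} (f : Vec N → ℝ) (c : Vec N → Vec M) (P : Params) (r : Iterates N)

/-- The conditions that a computed tangential step `t` must satisfy in order not to be reset to
zero. -/
def KeepsTangential (x n t : Vec N) : Prop :=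
  mv c x 0 - mv c x (n + t) ≥ P.κvm * (mv c x 0 - mv c x n) ∧
  ‖n + t‖ ≥ P.κntn * ‖n‖ ∧
  ‖Hv c x t‖ ≤ P.κht * ‖n + t‖ ^ 2

/-- The step computation of iteration `k`. -/
def ComputesSteps (k : ℕ) : Prop :=
  IsNormalStep c (r.x k) (r.δv k) (r.n k) (r.lamv k) ∧
  ((‖r.n k‖ ≤ P.κn * r.δs P k ∧
      ‖gp f c (r.x k) (r.H k) (r.n k)‖ ≥ P.κp * ‖gv c (r.x k)‖) →
    ∃ (t : Vec N) (lam : ℝ),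
      IsTangentialStep f c (r.x k) (r.H k) (r.n k) (r.δs P k) t lam ∧
      (KeepsTangential c P (r.x k) (r.n k) t → r.t k = t ∧ r.lamf k = lam) ∧
      (¬ KeepsTangential c P (r.x k) (r.n k) t → r.t k = 0 ∧ r.lamf k = 0)) ∧
  (¬ (‖r.n k‖ ≤ P.κn * r.δs P k ∧
      ‖gp f c (r.x k) (r.H k) (r.n k)‖ ≥ P.κp * ‖gv c (r.x k)‖) →
    r.t k = 0 ∧ r.lamf k = 0)

/-- The conditions under which iteration `k` is an F-iteration; otherwise it is a V-iteration. -/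
def IsFIteration (k : ℕ) : Prop :=
  (r.t k ≠ 0 ∧ ‖r.t k‖ ≥ P.κst * ‖r.s k‖) ∧
  mf f (r.x k) (r.H k) 0 - mf f (r.x k) (r.H k) (r.s k) ≥
    P.κfm * (mf f (r.x k) (r.H k) (r.n k) - mf f (r.x k) (r.H k) (r.s k)) ∧
  infeas c (r.x k + r.s k) ≤ r.vmax k - P.κρ * ‖r.s k‖ ^ 3 ∧
  ⟪r.n k, r.t k⟫_ℝ ≥ -(1 / 2) * P.κntt * ‖r.t k‖ ^ 2 ∧
  r.lamv k ≤ r.σv k * ‖r.n k‖ ∧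
  ‖(r.H k - hessian f (r.x k)) (r.s k)‖ ≤ P.κhs * ‖r.s k‖ ^ 2

/-- `ρᶠ_k`. -/
def rhof (k : ℕ) : ℝ := (f (r.x k) - f (r.x k + r.s k)) / ‖r.s k‖ ^ 3

/-- `ρᵛ_k` (of a V-iteration). -/
def rhov (k : ℕ) : ℝ := (infeas c (r.x k) - infeas c (r.x k + r.s k)) / ‖r.s k‖ ^ 3

/-- The contraction of the radius `δᶠ` in a rejected F-iteration. -/
def FContract (k : ℕ) : Prop :=
  (r.lamf k < P.σlo * ‖r.s k‖ →
    ∃ (lam : ℝ) (t : Vec N), r.lamf k < lam ∧ SolvesQf f c (r.x k) (r.H k) (r.n k) lam t ∧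
      P.σlo ≤ lam / ‖r.n k + t‖ ∧ r.δf (k + 1) = ‖r.n k + t‖) ∧
  (¬ r.lamf k < P.σlo * ‖r.s k‖ → r.δf (k + 1) = P.γc * ‖r.s k‖)

/-- The updates made in an F-iteration. -/
def FUpdate (k : ℕ) : Prop :=
  (P.κρ ≤ rhof f r k →
    r.x (k + 1) = r.x k + r.s k ∧
    r.vmax (k + 1) =
      min (max (P.κv1 * r.vmax k) (r.vmax k - P.κρ * ‖r.s k‖ ^ 3))
        (infeas c (r.x (k + 1)) + P.κv2 * (r.vmax k - infeas c (r.x (k + 1)))) ∧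
    r.δf (k + 1) = max (r.δf k) (P.γe * ‖r.s k‖)) ∧
  (¬ P.κρ ≤ rhof f r k →
    r.x (k + 1) = r.x k ∧ r.vmax (k + 1) = r.vmax k ∧ FContract f c P r k) ∧
  r.δv (k + 1) = r.δv k ∧ r.Δv (k + 1) = r.Δv k

/-- The contraction of the radius `δᵛ` in a rejected V-iteration. -/
def VContract (k : ℕ) : Prop :=
  (r.lamv k < P.σlo * ‖r.n k‖ →
    ∃ n₁ : Vec N,
      SolvesQv c (r.x k) (r.lamv k + Real.sqrt (P.σlo * ‖gv c (r.x k)‖)) n₁ ∧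
      ((r.lamv k + Real.sqrt (P.σlo * ‖gv c (r.x k)‖)) / ‖n₁‖ ≤ P.σhi →
        r.δv (k + 1) = ‖n₁‖) ∧
      (¬ (r.lamv k + Real.sqrt (P.σlo * ‖gv c (r.x k)‖)) / ‖n₁‖ ≤ P.σhi →
        ∃ (lam : ℝ) (n₂ : Vec N),
          lam ∈ Ioo (r.lamv k) (r.lamv k + Real.sqrt (P.σlo * ‖gv c (r.x k)‖)) ∧
          SolvesQv c (r.x k) lam n₂ ∧
          P.σlo ≤ lam / ‖n₂‖ ∧ lam / ‖n₂‖ ≤ P.σhi ∧ r.δv (k + 1) = ‖n₂‖)) ∧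
  (¬ r.lamv k < P.σlo * ‖r.n k‖ →
    ∃ n₁ : Vec N,
      SolvesQv c (r.x k) (P.γl * r.lamv k) n₁ ∧
      (P.γc * ‖r.n k‖ ≤ ‖n₁‖ → r.δv (k + 1) = ‖n₁‖) ∧
      (¬ P.γc * ‖r.n k‖ ≤ ‖n₁‖ → r.δv (k + 1) = P.γc * ‖r.n k‖))

/-- The condition for accepting the step of a V-iteration. -/
def VAccepts (k : ℕ) : Prop :=
  P.κρ ≤ rhov c r k ∧ (r.lamv k ≤ r.σv k * ‖r.n k‖ ∨ ‖r.n k‖ = r.Δv k)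

/-- The updates made in a V-iteration. -/
def VUpdate (k : ℕ) : Prop :=
  (VAccepts c P r k →
    r.x (k + 1) = r.x k + r.s k ∧
    r.vmax (k + 1) =
      min (max (P.κv1 * r.vmax k)
          (infeas c (r.x (k + 1)) + P.κv2 * (infeas c (r.x k) - infeas c (r.x (k + 1)))))
        (infeas c (r.x (k + 1)) + P.κv2 * (r.vmax k - infeas c (r.x (k + 1)))) ∧
    r.Δv (k + 1) = max (r.Δv k) (P.γe * ‖r.n k‖) ∧
    r.δv (k + 1) = min (r.Δv (k + 1)) (max (r.δv k) (P.γe * ‖r.n k‖))) ∧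
  (¬ VAccepts c P r k → r.x (k + 1) = r.x k ∧ r.vmax (k + 1) = r.vmax k ∧
    r.Δv (k + 1) = r.Δv k) ∧
  (¬ VAccepts c P r k → rhov c r k < P.κρ → VContract c P r k) ∧
  (¬ VAccepts c P r k → ¬ rhov c r k < P.κρ →
    r.δv (k + 1) = min (r.Δv (k + 1)) (r.lamv k / r.σv k)) ∧
  r.δf (k + 1) = r.δf k

/-- The update of `σᵛ` made in iteration `k + 1`. -/
def SigmaUpdate (k : ℕ) : Prop :=
  (IsFIteration f c P r k → r.σv (k + 1) = r.σv k) ∧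
  (¬ IsFIteration f c P r k →
    (rhov c r k < P.κρ →
      r.σv (k + 1) = max (r.σv k) (r.lamv (k + 1) / ‖r.n (k + 1)‖)) ∧
    (¬ rhov c r k < P.κρ → r.σv (k + 1) = r.σv k))

/-- The set `I` of iterations that are performed without terminating: `‖gᵛ_j‖ > ε` for all
`j ≤ k`. (The algorithm stops at the first `k` with `‖gᵛ_k‖ ≤ ε`; the entries of the sequences
after that index carry no meaning and are never used.) -/
def activeSet (ε : ℝ) : Set ℕ := {k | ∀ j ≤ k, ε < ‖gv c (r.x j)‖}

/-- The indices `k` for which the iterate `x_k` is generated, the final one included. -/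
def reachedSet (ε : ℝ) : Set ℕ := {k | ∀ j < k, ε < ‖gv c (r.x j)‖}

/-- `r` is generated by the trust funnel algorithm (phase 1) with tolerance `ε`. -/
structure IsRun (ε : ℝ) : Prop where
  vmax_init : max 1 (infeas c (r.x 0)) ≤ r.vmax 0
  σv_init : r.σv 0 ∈ Icc P.σlo P.σhi
  δv_init : 0 < r.δv 0
  Δv_init : r.δv 0 ≤ r.Δv 0
  δf_init : 0 < r.δf 0
  H_symm : ∀ k ∈ activeSet c r ε, IsSelfAdjoint (r.H k)
  steps : ∀ k ∈ activeSet c r ε, ComputesSteps f c P r k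
  sigma : ∀ k, k + 1 ∈ activeSet c r ε → SigmaUpdate f c P r k
  f_iter : ∀ k ∈ activeSet c r ε, IsFIteration f c P r k → FUpdate f c P r k
  v_iter : ∀ k ∈ activeSet c r ε, ¬ IsFIteration f c P r k → VUpdate c P r k
  /-- The normal step is determined by `(x_k, δᵛ_k)`, and the model Hessian is kept, as long as
  `(x_k, δᵛ_k)` does not change. -/
  unchanged : ∀ k, k + 1 ∈ activeSet c r ε → r.x (k + 1) = r.x k → r.δv (k + 1) = r.δv k →
    r.n (k + 1) = r.n k ∧ r.lamv (k + 1) = r.lamv k ∧ r.H (k + 1) = r.H k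

/-- The assumptions on the iterates: they stay in a compact set and the model Hessians are
bounded; `∇²v` and `∇²f` are Lipschitz continuous with constants `LHv` and `LHf` on the segments
between an iterate and its trial point; every constraint Jacobian has full row rank, and its `M`
singular values are at least `ζ`. -/
structure IterateAssumptions (ε LHv LHf ζ : ℝ) : Prop where
  compact : ∃ K : Set (Vec N), IsCompact K ∧ ∀ k ∈ reachedSet c r ε, r.x k ∈ K
  H_bounded : ∃ B : ℝ, ∀ k ∈ activeSet c r ε, ‖r.H k‖ ≤ B
  lipschitz_Hv : ∀ k ∈ activeSet c r ε,
    ∀ y ∈ segment ℝ (r.x k) (r.x k + r.s k), ∀ z ∈ segment ℝ (r.x k) (r.x k + r.s k),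
      ‖Hv c y - Hv c z‖ ≤ LHv * ‖y - z‖
  lipschitz_Hf : ∀ k ∈ activeSet c r ε,
    ∀ y ∈ segment ℝ (r.x k) (r.x k + r.s k), ∀ z ∈ segment ℝ (r.x k) (r.x k + r.s k),
      ‖hessian f y - hessian f z‖ ≤ LHf * ‖y - z‖
  full_row_rank : ∀ k ∈ reachedSet c r ε,
    Module.finrank ℝ (LinearMap.range (jac c (r.x k)).toLinearMap) = M
  singular_values : ∀ k ∈ reachedSet c r ε,
    ∀ i < M, ζ ≤ (jac c (r.x k)).toLinearMap.singularValues i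

/-- The generated iterates with `‖c_k‖ > ε / ζ`. -/
def infeasSet (ε ζ : ℝ) : Set ℕ := {k ∈ reachedSet c r ε | ε / ζ < ‖c (r.x k)‖}

end Algorithm

section Bound

variable (P : Params) (vmax0 Δ0 LHv LHf σmax ε : ℝ)

/-- `K_σ(ε)`. -/
def Kσ : ℤ :=
  ⌊vmax0 / (P.κρ * (1 - P.κv2) *
      (LHv + P.κht + σmax / P.κntn ^ 2) ^ (-(3 / 2) : ℝ)) * ε ^ (-(3 / 2) : ℝ)⌋

/-- `K_Δᵛ`. -/
def KΔ : ℤ := ⌊vmax0 / (P.κρ * P.κntn ^ 3 * (1 - P.κv2) * Δ0 ^ 3)⌋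

/-- `K_Cᵛ`. -/
def KCv : ℤ := 1 + ⌊1 / Real.log (min P.γl P.γc⁻¹) * Real.log (σmax / P.σlo)⌋

/-- `K_Cᶠ`. -/
def KCf : ℤ :=
  max 1 (2 + ⌊1 / Real.log P.γc⁻¹ *
    Real.log ((P.κhs + LHf + 2 * P.κρ) / (P.σlo * P.κfm * P.κst ^ 2 * (1 - P.κntt)))⌋)

/-- The iteration bound `K(ε)`. -/
def iterBound : ℤ :=
  (Kσ P vmax0 LHv σmax ε + KΔ P vmax0 Δ0 + 1) * (KCv P σmax + 2) * (KCf P LHf + 1)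

end Bound

end TrustFunnel

end

/-! Singular values of `J` bounded below by `ζ` give `ζ‖c‖ ≤ ‖Jᵀc‖ = ‖gᵛ‖` (`mul_norm_le_norm_gv`),
so the indices to be counted all precede termination. It then suffices to bound every active index
by `K(ε)` (`IsRun.natCast_lt_iterBound`).

Accepted steps are paid for out of `vmax`, which stays nonnegative and drops by at least `κρ(1 -
κv2)‖s‖³` at each of them (`IsRun.vmax_succ_of_accepted`). An accepted step has either `λᵛ ≤ σᵛ‖n‖`,
and then `ε < ‖gᵛ‖ ≤ const · ‖s‖²` at the new iterate if that is active (`norm_gv_add_le`), or `‖n‖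
= Δᵛ`, and then `‖s‖ ≥ κntn Δᵛ₀`. The two cases produce `Kσ` and `KΔ`.

Rejected steps are controlled by one monotonicity fact: the norm of a regularized solution decreases
as the multiplier grows (`IsRegularizedSolution.norm_le`). Shrinking a radius therefore raises the
ratio of multiplier to step length. From `σlo` on, a contraction of `δᵛ` multiplies `λᵛ/‖n‖` by at
least `min γl γc⁻¹` (`VContract.ratio`), while `σᵛ` dominates this ratio and is capped by `σmax`.
Likewise a contraction of `δᶠ` followed by another F-iteration multiplies the lower bound on
`λᶠ/‖s‖` by `γc⁻¹` (`FContract.mul_norm_le_lamf`), and a large ratio forces acceptance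
(`lamf_lt_of_rhof_lt`). Nesting the three counts (`CountInvariant`) gives the product `K(ε)`.

Finally, `σᵛ` is bounded independently of `ε`: a large `λᵛ/‖n‖` precludes a contraction
(`lamv_div_lt_of_rhov_lt`), and one contraction raises the ratio at most to the larger of `σhi` and
`γl/γc` times its old value. -/

noncomputable section

namespace TrustFunnel

/-! ### Taylor estimates under a Lipschitz Hessian, and the gradient of `v`. -/

section Calculus

variable {N M : ℕ} {φ : Vec N → ℝ}

lemma contDiff_gradient (hφ : ContDiff ℝ 2 φ) : ContDiff ℝ 1 (gradient φ) :=
  (InnerProductSpace.toDual ℝ (Vec N)).symm.contDiff.comp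
    (hφ.fderiv_right (m := 1) (by norm_num))

lemma hasFDerivAt_gradient (hφ : ContDiff ℝ 2 φ) (x : Vec N) :
    HasFDerivAt (gradient φ) (hessian φ x) x :=
  ((contDiff_gradient hφ).differentiable (by norm_num) x).hasFDerivAt

lemma inner_hessian (hφ : ContDiff ℝ 2 φ) (x u w : Vec N) :
    ⟪w, hessian φ x u⟫_ℝ = fderiv ℝ (fderiv ℝ φ) x u w := by
  have h1 : HasFDerivAt (fun y => ⟪w, gradient φ y⟫_ℝ)
      ((innerSL ℝ w).comp (hessian φ x)) x :=
    (innerSL ℝ w).hasFDerivAt.comp x (hasFDerivAt_gradient hφ x)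
  have hd : DifferentiableAt ℝ (fderiv ℝ φ) x :=
    (hφ.fderiv_right (m := 1) (by norm_num)).differentiable (by norm_num) x
  have h2 : HasFDerivAt (fun y => ⟪w, gradient φ y⟫_ℝ)
      ((ContinuousLinearMap.apply ℝ ℝ w).comp (fderiv ℝ (fderiv ℝ φ) x)) x := by
    have h := (ContinuousLinearMap.apply ℝ ℝ w).hasFDerivAt.comp x hd.hasFDerivAt
    refine h.congr_of_eventuallyEq (Filter.Eventually.of_forall fun y => ?_)
    simp [inner_gradient_right]
  exact congrArg (fun A : Vec N →L[ℝ] ℝ => A u) (h1.unique h2)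

lemma hessian_isSymmetric (hφ : ContDiff ℝ 2 φ) (x u w : Vec N) :
    ⟪hessian φ x u, w⟫_ℝ = ⟪u, hessian φ x w⟫_ℝ := by
  rw [real_inner_comm, inner_hessian hφ, inner_hessian hφ]
  exact (hφ.contDiffAt.isSymmSndFDerivAt (by simp)) u w

/-- The mean value inequality for `∇φ` with reference derivative `hessian φ x`. It yields `L`
instead of the sharp `L / 2`; the constants of the theorem leave room for that. -/
lemma norm_gradient_add_sub_le (hφ : ContDiff ℝ 2 φ) {x s : Vec N} {L : ℝ} (hL0 : 0 ≤ L)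
    (hL : ∀ y ∈ segment ℝ x (x + s), ∀ z ∈ segment ℝ x (x + s),
      ‖hessian φ y - hessian φ z‖ ≤ L * ‖y - z‖) {τ : ℝ} (hτ : τ ∈ Icc (0 : ℝ) 1) :
    ‖gradient φ (x + τ • s) - gradient φ x - τ • hessian φ x s‖ ≤ L * τ ^ 2 * ‖s‖ ^ 2 := by
  have hmem : ∀ θ ∈ Icc (0 : ℝ) 1, x + θ • s ∈ segment ℝ x (x + s) := fun θ hθ => by
    rw [segment_eq_image']; exact ⟨θ, hθ, by simp⟩
  have hseg : ∀ z ∈ segment ℝ x (x + τ • s),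
      ‖fderiv ℝ (gradient φ) z - hessian φ x‖ ≤ L * (τ * ‖s‖) := by
    intro z hz
    rw [segment_eq_image'] at hz
    obtain ⟨θ, hθ, rfl⟩ := hz
    have hz : x + θ • (x + τ • s - x) = x + (θ * τ) • s := by simp [smul_smul]
    have h0 : x ∈ segment ℝ x (x + s) := left_mem_segment ℝ _ _
    have hθτ : θ * τ ≤ τ := by nlinarith [hθ.1, hθ.2, hτ.1]
    have := hL _ (hmem (θ * τ) ⟨mul_nonneg hθ.1 hτ.1, hθτ.trans hτ.2⟩) x h0
    simp only [hz]
    refine this.trans ?_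
    rw [add_sub_cancel_left, norm_smul, Real.norm_of_nonneg (mul_nonneg hθ.1 hτ.1)]
    have := mul_nonneg hθ.1 hτ.1
    gcongr
  have h := (convex_segment x (x + τ • s)).norm_image_sub_le_of_norm_fderiv_le'
    (fun z _ => (contDiff_gradient hφ).differentiable (by norm_num) z) hseg
    (left_mem_segment ℝ _ _) (right_mem_segment ℝ _ _)
  rw [add_sub_cancel_left, map_smul, norm_smul, Real.norm_of_nonneg hτ.1] at h
  exact h.trans_eq (by ring)

/-- Comparison of derivatives along the segment: the gradient remainder `L τ² ‖s‖³` integrates to `L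
/ 3 * ‖s‖ ^ 3`. -/
lemma image_add_le_taylor (hφ : ContDiff ℝ 2 φ) {x s : Vec N} {L : ℝ} (hL0 : 0 ≤ L)
    (hL : ∀ y ∈ segment ℝ x (x + s), ∀ z ∈ segment ℝ x (x + s),
      ‖hessian φ y - hessian φ z‖ ≤ L * ‖y - z‖) :
    φ (x + s) ≤ φ x + ⟪gradient φ x, s⟫_ℝ + 1 / 2 * ⟪s, hessian φ x s⟫_ℝ + L / 3 * ‖s‖ ^ 3 := by
  have hline : ∀ τ : ℝ, HasDerivAt (fun τ : ℝ => x + τ • s) s τ := fun τ => by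
    simpa using ((hasDerivAt_id τ).smul_const s).const_add x
  have hder : ∀ τ : ℝ, HasDerivAt (fun τ : ℝ => φ (x + τ • s))
      ⟪gradient φ (x + τ • s), s⟫_ℝ τ := fun τ => by
    have h := ((hφ.differentiable (by norm_num) (x + τ • s)).hasFDerivAt).comp_hasDerivAt τ
      (hline τ)
    rwa [inner_gradient_left]
  have hB : ∀ τ : ℝ, HasDerivAt (fun τ : ℝ => φ x + τ * ⟪gradient φ x, s⟫_ℝ
      + τ ^ 2 * (1 / 2 * ⟪s, hessian φ x s⟫_ℝ) + τ ^ 3 * (L / 3 * ‖s‖ ^ 3))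
      (⟪gradient φ x, s⟫_ℝ + τ * ⟪s, hessian φ x s⟫_ℝ + τ ^ 2 * (L * ‖s‖ ^ 3)) τ := fun τ => by
    have h := ((((hasDerivAt_id τ).mul_const ⟪gradient φ x, s⟫_ℝ).const_add (φ x)).add
      (((hasDerivAt_id τ).pow 2).mul_const (1 / 2 * ⟪s, hessian φ x s⟫_ℝ))).add
      (((hasDerivAt_id τ).pow 3).mul_const (L / 3 * ‖s‖ ^ 3))
    refine h.congr_deriv ?_
    simp; ring
  have key := image_le_of_deriv_right_le_deriv_boundary (a := 0) (b := 1)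
    (fun τ _ => (hder τ).continuousAt.continuousWithinAt)
    (fun τ _ => (hder τ).hasDerivWithinAt) (by simp)
    (fun τ _ => (hB τ).continuousAt.continuousWithinAt)
    (fun τ _ => (hB τ).hasDerivWithinAt) (fun τ hτ => ?_) (right_mem_Icc.2 zero_le_one)
  · simpa using key
  · have h := norm_gradient_add_sub_le hφ hL0 hL (Ico_subset_Icc_self hτ)
    have h' := (real_inner_le_norm
      (gradient φ (x + τ • s) - gradient φ x - τ • hessian φ x s) s).trans
      (mul_le_mul_of_nonneg_right h (norm_nonneg s))
    rw [inner_sub_left, inner_sub_left, real_inner_smul_left,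
      real_inner_comm s (hessian φ x s)] at h'
    linarith [h', show L * τ ^ 2 * ‖s‖ ^ 2 * ‖s‖ = τ ^ 2 * (L * ‖s‖ ^ 3) by ring]

lemma norm_gradient_add_le (hφ : ContDiff ℝ 2 φ) {x s : Vec N} {L : ℝ} (hL0 : 0 ≤ L)
    (hL : ∀ y ∈ segment ℝ x (x + s), ∀ z ∈ segment ℝ x (x + s),
      ‖hessian φ y - hessian φ z‖ ≤ L * ‖y - z‖) :
    ‖gradient φ (x + s)‖ ≤ ‖gradient φ x + hessian φ x s‖ + L * ‖s‖ ^ 2 := by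
  have h := norm_gradient_add_sub_le hφ hL0 hL (right_mem_Icc.2 zero_le_one)
  rw [one_smul, one_smul, one_pow, mul_one, sub_sub] at h
  linarith [norm_le_norm_add_norm_sub' (gradient φ (x + s)) (gradient φ x + hessian φ x s)]

variable {c : Vec N → Vec M}

lemma contDiff_infeas (hc : ContDiff ℝ 2 c) : ContDiff ℝ 2 (infeas c) :=
  contDiff_const.mul (hc.norm_sq ℝ)

lemma infeas_nonneg (c : Vec N → Vec M) (x : Vec N) : 0 ≤ infeas c x := by
  unfold infeas; positivity

lemma gv_eq_adjoint (hc : ContDiff ℝ 2 c) (x : Vec N) :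
    gv c x = (ContinuousLinearMap.adjoint (jac c x)) (c x) := by
  refine ext_inner_right ℝ fun w => ?_
  have h1 : HasFDerivAt c (jac c x) x := (hc.differentiable (by norm_num) x).hasFDerivAt
  have h := (h1.norm_sq.const_mul (1 / 2)).fderiv
  rw [gv, inner_gradient_left, ContinuousLinearMap.adjoint_inner_left]
  change fderiv ℝ (fun y => 1 / 2 * ‖c y‖ ^ 2) x w = _
  rw [h]
  simp

end Calculus

/-! ### Bounded preimages from singular values, and `ζ‖c‖ ≤ ‖gᵛ‖`. -/

section SingularValues

variable {E F : Type*} [NormedAddCommGroup E] [InnerProductSpace ℝ E] [FiniteDimensional ℝ E]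
  [NormedAddCommGroup F] [InnerProductSpace ℝ F] [FiniteDimensional ℝ F]

/-- Take any preimage and keep only its components along the right singular vectors of index below
the rank: the others are killed by `T`, and on the kept ones `T` expands by at least `ζ`. -/
lemma exists_preimage_norm_le (T : E →ₗ[ℝ] F) {ζ : ℝ} (hζ : 0 ≤ ζ)
    (h : ∀ i < Module.finrank ℝ (LinearMap.range T), ζ ≤ T.singularValues i)
    {y : F} (hy : y ∈ LinearMap.range T) :
    ∃ w, T w = y ∧ ζ * ‖w‖ ≤ ‖y‖ := by
  classical
  obtain ⟨w₀, rfl⟩ := hy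
  set S := LinearMap.adjoint T ∘ₗ T
  have hS : S.IsSymmetric := T.isSymmetric_adjoint_comp_self
  set b := hS.eigenvectorBasis rfl
  set m := Module.finrank ℝ (LinearMap.range T)
  have hnorm : ∀ w : E, ‖T w‖ ^ 2 =
      ∑ i : Fin (Module.finrank ℝ E), T.singularValues i ^ 2 * ⟪b i, w⟫_ℝ ^ 2 := by
    intro w
    rw [← real_inner_self_eq_norm_sq, ← LinearMap.adjoint_inner_right]
    change ⟪w, S w⟫_ℝ = _
    rw [← b.sum_inner_mul_inner]
    refine Finset.sum_congr rfl fun i _ => ?_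
    have : ⟪b i, S w⟫_ℝ = T.singularValues i ^ 2 * ⟪b i, w⟫_ℝ := by
      rw [← hS, hS.apply_eigenvectorBasis, T.sq_singularValues_fin rfl]
      simp [real_inner_smul_left, b, S]
    rw [this, real_inner_comm w (b i)]
    ring
  set w : E := ∑ i : Fin (Module.finrank ℝ E),
    (if (i : ℕ) < m then ⟪b i, w₀⟫_ℝ else 0) • b i with hw
  have hcoord : ∀ i : Fin (Module.finrank ℝ E), ⟪b i, w⟫_ℝ =
      if (i : ℕ) < m then ⟪b i, w₀⟫_ℝ else 0 := fun i => by
    rw [hw, b.orthonormal.inner_right_fintype]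
  have hTw : T w = T w₀ := by
    rw [← sub_eq_zero, ← map_sub, ← norm_eq_zero, ← sq_eq_zero_iff, hnorm]
    refine Finset.sum_eq_zero fun i _ => ?_
    rw [inner_sub_right, hcoord]
    split_ifs with him
    · simp
    · rw [(T.singularValues_eq_zero_iff_le_finrank_range).2 (not_lt.1 him)]; simp
  refine ⟨w, hTw, ?_⟩
  rw [← hTw]
  refine le_of_sq_le_sq ?_ (norm_nonneg _)
  rw [mul_pow, hnorm, ← real_inner_self_eq_norm_sq, ← b.sum_inner_mul_inner, Finset.mul_sum]
  refine Finset.sum_le_sum fun i _ => ?_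
  rw [real_inner_comm (b i) w, hcoord]
  split_ifs with him
  · rw [← sq]
    gcongr
    exact h i him
  · simp

end SingularValues

/-- Test `Jᵀc` against a short solution `w` of `J w = c`: `‖c‖² = ⟪Jᵀc, w⟫` with `ζ‖w‖ ≤ ‖c‖`.
Surjectivity of `J` supplies `w`. -/
lemma mul_norm_le_norm_gv {N M : ℕ} {c : Vec N → Vec M} (hc : ContDiff ℝ 2 c) {x : Vec N} {ζ : ℝ}
    (hζ : 0 ≤ ζ) (hrank : Module.finrank ℝ (LinearMap.range (jac c x).toLinearMap) = M)
    (hsing : ∀ i < M, ζ ≤ (jac c x).toLinearMap.singularValues i) :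
    ζ * ‖c x‖ ≤ ‖gv c x‖ := by
  have htop : LinearMap.range (jac c x).toLinearMap = ⊤ :=
    Submodule.eq_top_of_finrank_eq (by rw [hrank]; simp)
  obtain ⟨w, hw, hle⟩ := exists_preimage_norm_le (jac c x).toLinearMap hζ
    (by rwa [hrank]) (y := c x) (by rw [htop]; trivial)
  have hw' : jac c x w = c x := hw
  have h1 : ‖c x‖ ^ 2 ≤ ‖gv c x‖ * ‖w‖ := by
    rw [gv_eq_adjoint hc, ← real_inner_self_eq_norm_sq]
    nth_rewrite 2 [← hw']
    rw [← ContinuousLinearMap.adjoint_inner_left]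
    exact real_inner_le_norm _ _
  rcases (norm_nonneg (c x)).eq_or_lt with h0 | h0
  · rw [← h0, mul_zero]; positivity
  · refine le_of_mul_le_mul_right ?_ h0
    calc ζ * ‖c x‖ * ‖c x‖ = ζ * ‖c x‖ ^ 2 := by ring
      _ ≤ ζ * (‖gv c x‖ * ‖w‖) := by gcongr
      _ = ‖gv c x‖ * (ζ * ‖w‖) := by ring
      _ ≤ ‖gv c x‖ * ‖c x‖ := by gcongr


/-! ### Monotonicity of regularized quadratic subproblems in the multiplier. -/

section Regularized

variable {E : Type*} [NormedAddCommGroup E] [InnerProductSpace ℝ E]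

/-- First- and second-order optimality of `p` for `gᵀp + ½ pᵀ(H + lam I)p` along the
subspace `K`. -/
structure IsRegularizedSolution (K : Submodule ℝ E) (g : E) (H : E →L[ℝ] E) (lam : ℝ) (p : E) :
    Prop where
  stationary : ∀ w ∈ K, ⟪g + (H p + lam • p), w⟫_ℝ = 0
  psd : ∀ w ∈ K, 0 ≤ ⟪w, H w + lam • w⟫_ℝ

namespace IsRegularizedSolution

variable {K : Submodule ℝ E} {g : E} {H : E →L[ℝ] E} {lam lam' : ℝ} {p p' : E}

/-- Subtracting the two stationarity conditions along `d = p' - p` gives `(lam' - lam)⟪p', d⟫ = -⟪d,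
(H + lam)d⟫`. The solutions themselves need not lie in `K`, only their difference, which covers the
shifted tangential problem. -/
lemma inner_sub_nonpos (h : IsRegularizedSolution K g H lam p)
    (h' : IsRegularizedSolution K g H lam' p') (hK : p' - p ∈ K) (hlt : lam < lam') :
    ⟪p', p' - p⟫_ℝ ≤ 0 := by
  have e1 := h.stationary _ hK
  have e2 := h'.stationary _ hK
  have e3 := h.psd _ hK
  have e4 : ⟪p' - p, p' - p⟫_ℝ = ⟪p', p' - p⟫_ℝ - ⟪p, p' - p⟫_ℝ := inner_sub_left _ _ _
  rw [map_sub, real_inner_comm] at e3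
  generalize p' - p = d at *
  simp only [inner_add_left, inner_sub_left, real_inner_smul_left] at e1 e2 e3
  rw [e4] at e3
  have h5 : (lam' - lam) * ⟪p', d⟫_ℝ ≤ 0 := by linarith
  exact nonpos_of_mul_nonpos_right h5 (sub_pos.2 hlt)

lemma norm_le (h : IsRegularizedSolution K g H lam p)
    (h' : IsRegularizedSolution K g H lam' p') (hK : p' - p ∈ K) (hlt : lam < lam') :
    ‖p'‖ ≤ ‖p‖ := by
  have h1 := inner_sub_nonpos h h' hK hlt
  rw [inner_sub_right, real_inner_self_eq_norm_sq] at h1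
  have h2 := real_inner_le_norm p' p
  by_contra! h3
  nlinarith [norm_nonneg p, norm_nonneg p']

/-- The equality case of the monotonicity: strict decrease can fail only in this degenerate
situation, which `g ≠ 0` excludes for `K = ⊤` and the angle test `nᵀt ≥ -½κntt‖t‖²` excludes for the
tangential problem. -/
lemma orthogonal_of_norm_le (h : IsRegularizedSolution K g H lam p)
    (h' : IsRegularizedSolution K g H lam' p') (hK : p' - p ∈ K) (hlt : lam < lam')
    (hle : ‖p‖ ≤ ‖p'‖) : p' = p ∧ ∀ w ∈ K, ⟪p, w⟫_ℝ = 0 := by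
  have h1 := inner_sub_nonpos h h' hK hlt
  have heq : p' = p := by
    rw [← sub_eq_zero, ← norm_eq_zero, ← sq_eq_zero_iff]
    refine le_antisymm ?_ (sq_nonneg _)
    rw [norm_sub_sq_real]
    rw [inner_sub_right, real_inner_self_eq_norm_sq] at h1
    nlinarith [norm_nonneg p]
  subst heq
  refine ⟨rfl, fun w hw => ?_⟩
  have e1 := h.stationary w hw
  have e2 := h'.stationary w hw
  simp only [inner_add_left, real_inner_smul_left] at e1 e2
  have : (lam' - lam) * ⟪p', w⟫_ℝ = 0 := by linarith
  exact (mul_eq_zero.1 this).resolve_left (sub_ne_zero.2 hlt.ne')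

lemma psd_mono (h : IsRegularizedSolution K g H lam p) (hle : lam ≤ lam') :
    ∀ w ∈ K, 0 ≤ ⟪w, H w + lam' • w⟫_ℝ := fun w hw => by
  have := h.psd w hw
  simp only [inner_add_right, real_inner_smul_right] at this ⊢
  nlinarith [real_inner_self_nonneg (x := w)]

lemma ne_zero (h : IsRegularizedSolution ⊤ g H lam p) (hg : g ≠ 0) : p ≠ 0 := by
  rintro rfl
  have := h.stationary g trivial
  simp [hg] at this

lemma norm_lt (h : IsRegularizedSolution ⊤ g H lam p)
    (h' : IsRegularizedSolution ⊤ g H lam' p') (hg : g ≠ 0) (hlt : lam < lam') :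
    ‖p'‖ < ‖p‖ := by
  by_contra! hle
  have := (orthogonal_of_norm_le h h' trivial hlt hle).2 p trivial
  exact h.ne_zero hg (inner_self_eq_zero.1 this)

end IsRegularizedSolution

/-- Along `t + τ • w` the increase of the objective is a nonnegative quadratic in `τ` without
constant term, so its discriminant, the square of the linear coefficient, vanishes. -/
lemma stationary_of_forall_le {K : Submodule ℝ E} {g : E} {A : E → E} {t : E}
    (hadd : ∀ u w, A (u + w) = A u + A w) (hsmul : ∀ (τ : ℝ) u, A (τ • u) = τ • A u)
    (hsymm : ∀ u w, ⟪A u, w⟫_ℝ = ⟪u, A w⟫_ℝ) (ht : t ∈ K)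
    (hmin : ∀ t' ∈ K, ⟪g, t⟫_ℝ + 1 / 2 * ⟪t, A t⟫_ℝ ≤ ⟪g, t'⟫_ℝ + 1 / 2 * ⟪t', A t'⟫_ℝ) :
    ∀ w ∈ K, ⟪g + A t, w⟫_ℝ = 0 := by
  intro w hw
  have key : ∀ τ : ℝ, 0 ≤ 1 / 2 * ⟪w, A w⟫_ℝ * (τ * τ) + ⟪g + A t, w⟫_ℝ * τ + 0 := fun τ => by
    have h := hmin (t + τ • w) (K.add_mem ht (K.smul_mem τ hw))
    have hs : ⟪t, A w⟫_ℝ = ⟪A t, w⟫_ℝ := (hsymm t w).symm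
    simp only [hadd, hsmul, inner_add_left, inner_add_right, real_inner_smul_left,
      real_inner_smul_right, hs, real_inner_comm (A t) w] at h ⊢
    linarith
  have := discrim_le_zero key
  rw [discrim] at this
  exact pow_eq_zero_iff two_ne_zero |>.1 (le_antisymm (by linarith) (sq_nonneg _))

end Regularized

/-! ### The normal step and its multiplier as functions of the radius. -/

section Normal

variable {N M : ℕ} {c : Vec N → Vec M} {x : Vec N}

lemma Hv_isSymmetric (hc : ContDiff ℝ 2 c) (x u w : Vec N) :
    ⟪Hv c x u, w⟫_ℝ = ⟪u, Hv c x w⟫_ℝ :=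
  hessian_isSymmetric (contDiff_infeas hc) x u w

lemma IsNormalStep.isRegularizedSolution {δ lam : ℝ} {n : Vec N}
    (h : IsNormalStep c x δ n lam) :
    IsRegularizedSolution ⊤ (gv c x) (Hv c x) lam n :=
  ⟨fun w _ => by rw [h.dual, inner_zero_left], fun w _ => h.psd w⟩

lemma SolvesQv.isRegularizedSolution (hc : ContDiff ℝ 2 c) {lam lam' : ℝ} {n p : Vec N}
    (h : SolvesQv c x lam' n) (hp : IsRegularizedSolution ⊤ (gv c x) (Hv c x) lam p)
    (hle : lam ≤ lam') : IsRegularizedSolution ⊤ (gv c x) (Hv c x) lam' n := by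
  refine ⟨?_, hp.psd_mono hle⟩
  refine stationary_of_forall_le (A := fun n => Hv c x n + lam' • n) (fun u w => ?_)
    (fun τ u => ?_) (fun u w => ?_) trivial fun t' _ => ?_
  · rw [map_add, smul_add]; abel
  · rw [map_smul, smul_add, smul_comm]
  · simp only [inner_add_left, inner_add_right, real_inner_smul_left, real_inner_smul_right,
      Hv_isSymmetric hc]
  · linarith [h t']

variable {δ lam lam₁ : ℝ} {n n₁ : Vec N}

namespace IsNormalStep

lemma ne_zero (h : IsNormalStep c x δ n lam) (hg : gv c x ≠ 0) : n ≠ 0 :=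
  h.isRegularizedSolution.ne_zero hg

lemma norm_eq (h : IsNormalStep c x δ n lam) (hlam : 0 < lam) : ‖n‖ = δ := by
  have := (mul_eq_zero.1 h.comp).resolve_left hlam.ne'
  linarith

/-- A larger positive multiplier would put `n` on the boundary, `‖n‖ = δ`, and yet make it strictly
shorter than `n₁`. -/
lemma multiplier_le (h : IsNormalStep c x δ n lam) (hg : gv c x ≠ 0)
    (h₁ : IsRegularizedSolution ⊤ (gv c x) (Hv c x) lam₁ n₁) (h0 : 0 ≤ lam₁) (hle : ‖n₁‖ ≤ δ) :
    lam ≤ lam₁ := by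
  by_contra! hlt
  have := h₁.norm_lt h.isRegularizedSolution hg hlt
  rw [h.norm_eq (h0.trans_lt hlt)] at this
  linarith

lemma le_multiplier (h : IsNormalStep c x δ n lam) (hg : gv c x ≠ 0)
    (h₁ : IsRegularizedSolution ⊤ (gv c x) (Hv c x) lam₁ n₁) (hle : δ ≤ ‖n₁‖) :
    lam₁ ≤ lam := by
  by_contra! hlt
  linarith [h.isRegularizedSolution.norm_lt h₁ hg hlt, h.feasible]

lemma multiplier_eq (h : IsNormalStep c x δ n lam) (hg : gv c x ≠ 0)
    (h₁ : IsRegularizedSolution ⊤ (gv c x) (Hv c x) lam₁ n₁) (h0 : 0 < lam₁) (heq : δ = ‖n₁‖) :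
    lam = lam₁ ∧ ‖n‖ = ‖n₁‖ := by
  have e := le_antisymm (h.multiplier_le hg h₁ h0.le heq.ge) (h.le_multiplier hg h₁ heq.le)
  exact ⟨e, by rw [h.norm_eq (e ▸ h0), heq]⟩

lemma model_decrease (h : IsNormalStep c x δ n lam) :
    1 / 2 * lam * ‖n‖ ^ 2 ≤ mv c x 0 - mv c x n := by
  have h1 : ⟪gv c x + (Hv c x n + lam • n), n⟫_ℝ = 0 := by rw [h.dual, inner_zero_left]
  have h2 := h.psd n
  simp only [inner_add_left, inner_add_right, real_inner_smul_left, real_inner_smul_right,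
    real_inner_self_eq_norm_sq, real_inner_comm n (Hv c x n)] at h1 h2
  simp only [mv, inner_zero_right, map_zero]
  linarith

end IsNormalStep

/-- The multiplier-to-step ratio at the shifted multiplier is at least `σ`. -/
lemma le_div_norm_of_shift {σ : ℝ} (hσ : 0 < σ) (hg : gv c x ≠ 0) (hlam : 0 ≤ lam)
    (h : IsRegularizedSolution ⊤ (gv c x) (Hv c x) lam n)
    (h₁ : IsRegularizedSolution ⊤ (gv c x) (Hv c x) (lam + √(σ * ‖gv c x‖)) n₁) :
    σ ≤ (lam + √(σ * ‖gv c x‖)) / ‖n₁‖ := by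
  have hg' : 0 < ‖gv c x‖ := norm_pos_iff.2 hg
  have hn : 0 < ‖n₁‖ := norm_pos_iff.2 (h₁.ne_zero hg)
  set q := √(σ * ‖gv c x‖) with hq
  have hq0 : 0 < q := Real.sqrt_pos.2 (by positivity)
  have hqq : q * q = σ * ‖gv c x‖ := Real.mul_self_sqrt (by positivity)
  have h1 := h₁.stationary n₁ trivial
  have h2 := h.psd n₁ trivial
  have h3 : -⟪gv c x, n₁⟫_ℝ ≤ ‖gv c x‖ * ‖n₁‖ := by
    rw [← inner_neg_left, ← norm_neg (gv c x)]; exact real_inner_le_norm _ _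
  simp only [inner_add_left, inner_add_right, real_inner_smul_left, real_inner_smul_right,
    real_inner_self_eq_norm_sq, real_inner_comm n₁ (Hv c x n₁)] at h1 h2
  -- Stationarity tested with `n₁`, after discarding the nonnegative `⟪n₁, (Hᵛ + lam)n₁⟫`. The shift
  -- `q` is chosen so that `q² = σ‖gᵛ‖` turns this into `σ‖n₁‖ ≤ q`.
  have h4 : q * ‖n₁‖ ≤ ‖gv c x‖ := by
    refine le_of_mul_le_mul_right ?_ hn
    nlinarith
  rw [le_div_iff₀ hn]
  have h5 : σ * ‖n₁‖ ≤ q := by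
    refine le_of_mul_le_mul_right ?_ hq0
    calc σ * ‖n₁‖ * q = σ * (q * ‖n₁‖) := by ring
      _ ≤ σ * ‖gv c x‖ := by gcongr
      _ = q * q := hqq.symm
  linarith

end Normal


/-! ### The tangential step, viewed through the full vector `n + t`. -/

section Tangential

variable {N M : ℕ} {f : Vec N → ℝ} {c : Vec N → Vec M} {x : Vec N} {H : Vec N →L[ℝ] Vec N}
  {n t t' t₁ : Vec N} {δ δ' lam lam' lam₁ : ℝ}

lemma IsTangentialStep.isRegularizedSolution (h : IsTangentialStep f c x H n δ t lam) :
    IsRegularizedSolution (LinearMap.ker (jac c x).toLinearMap) (gradient f x) H lam (n + t) := by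
  refine ⟨fun w hw => ?_, fun w hw => h.psd w hw⟩
  obtain ⟨y, hy⟩ := h.dual
  have e : gradient f x + (H (n + t) + lam • (n + t)) =
      -(ContinuousLinearMap.adjoint (jac c x)) y := by
    rw [map_add, smul_add, eq_neg_iff_add_eq_zero]
    rw [eq_neg_iff_add_eq_zero] at hy
    rw [← hy]; abel
  have hw' : jac c x w = 0 := hw
  rw [e, inner_neg_left, ContinuousLinearMap.adjoint_inner_left, hw', inner_zero_right, neg_zero]

lemma SolvesQf.isRegularizedSolution (hH : IsSelfAdjoint H) (h : SolvesQf f c x H n lam' t)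
    {p : Vec N}
    (hp : IsRegularizedSolution (LinearMap.ker (jac c x).toLinearMap) (gradient f x) H lam p)
    (hle : lam ≤ lam') :
    IsRegularizedSolution (LinearMap.ker (jac c x).toLinearMap) (gradient f x) H lam' (n + t) := by
  refine ⟨fun w hw => ?_, hp.psd_mono hle⟩
  have h1 := stationary_of_forall_le (K := LinearMap.ker (jac c x).toLinearMap)
    (g := gradient f x + (H n + lam' • n)) (A := fun n => H n + lam' • n) (t := t) (fun u w => ?_)
    (fun τ u => ?_) (fun u w => ?_) h.1 (fun t' ht' => h.2 t' ht') w hw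
  · rw [← h1, map_add, smul_add]; congr 1; abel
  · rw [map_add, smul_add]; abel
  · rw [map_smul, smul_add, smul_comm]
  · have hs : ⟪H u, w⟫_ℝ = ⟪u, H w⟫_ℝ := hH.isSymmetric u w
    simp only [inner_add_left, inner_add_right, real_inner_smul_left, real_inner_smul_right, hs]

namespace IsTangentialStep

lemma sub_mem_ker (h : jac c x t = 0) (h' : jac c x t' = 0) :
    (n + t) - (n + t') ∈ LinearMap.ker (jac c x).toLinearMap := by
  rw [add_sub_add_left_eq_sub]
  exact Submodule.sub_mem _ h h'

lemma multiplier_mono (h : IsTangentialStep f c x H n δ t lam)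
    (h' : IsTangentialStep f c x H n δ' t' lam') (hlt : δ' < ‖n + t‖) : lam ≤ lam' := by
  by_contra! hlam
  have := h'.isRegularizedSolution.norm_le h.isRegularizedSolution
    (sub_mem_ker h.null h'.null) hlam
  linarith [h'.feasible]

/-- If `lam' < lam₁`, then `‖n + t'‖ ≤ δ' ≤ ‖n + t₁‖` is the degenerate case, so `n + t'` is
orthogonal to `t'`; but the angle condition makes `⟪n + t', t'⟫` positive. -/
lemma le_multiplier (hH : IsSelfAdjoint H) (h : IsTangentialStep f c x H n δ t lam)
    (h' : IsTangentialStep f c x H n δ' t' lam') (h₁ : SolvesQf f c x H n lam₁ t₁)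
    (hlam : lam < lam₁) (hδ : δ' ≤ ‖n + t₁‖) (ht' : t' ≠ 0) {κ : ℝ} (hκ : κ < 1)
    (hnt : ⟪n, t'⟫_ℝ ≥ -(1 / 2) * κ * ‖t'‖ ^ 2) : lam₁ ≤ lam' := by
  by_contra! hlt
  have := (h'.isRegularizedSolution.orthogonal_of_norm_le
    (h₁.isRegularizedSolution hH h.isRegularizedSolution hlam.le) (sub_mem_ker h₁.1 h'.null) hlt
    (h'.feasible.trans hδ)).2 t' h'.null
  rw [inner_add_left, real_inner_self_eq_norm_sq] at this
  have ht : 0 < ‖t'‖ ^ 2 := by have := norm_pos_iff.2 ht'; positivity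
  nlinarith

/-- By stationarity the decrease equals `½⟪t, (H + lam)t⟫ + lam(½‖t‖² + ⟪n, t⟫)`; the angle
condition bounds the last term. -/
lemma model_decrease (hH : IsSelfAdjoint H) (h : IsTangentialStep f c x H n δ t lam) {κ : ℝ}
    (hnt : ⟪n, t⟫_ℝ ≥ -(1 / 2) * κ * ‖t‖ ^ 2) :
    1 / 2 * lam * (1 - κ) * ‖t‖ ^ 2 ≤ mf f x H n - mf f x H (n + t) := by
  have h1 := h.isRegularizedSolution.stationary t h.null
  have h2 := h.psd t h.null
  have hs : ⟪H n, t⟫_ℝ = ⟪n, H t⟫_ℝ := hH.isSymmetric n t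
  have h3 := mul_le_mul_of_nonneg_left hnt h.lam_nonneg
  simp only [mf, map_add, inner_add_left, inner_add_right, real_inner_smul_left, hs,
    real_inner_smul_right, smul_add, real_inner_self_eq_norm_sq, real_inner_comm t (H t),
    real_inner_comm (H n) t] at h1 h2 ⊢
  linarith

end IsTangentialStep

end Tangential

/-! ### Consequences of acceptance and rejection within one iteration. -/

section Steps

variable {N M : ℕ} {f : Vec N → ℝ} {c : Vec N → Vec M} {P : Params} {r : Iterates N} {k : ℕ}

lemma ComputesSteps.isTangentialStep (h : ComputesSteps f c P r k) (ht : r.t k ≠ 0) :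
    IsTangentialStep f c (r.x k) (r.H k) (r.n k) (r.δs P k) (r.t k) (r.lamf k) := by
  by_cases hcond : ‖r.n k‖ ≤ P.κn * r.δs P k ∧
      ‖gp f c (r.x k) (r.H k) (r.n k)‖ ≥ P.κp * ‖gv c (r.x k)‖
  · obtain ⟨t, lam, h1, h2, h3⟩ := h.2.1 hcond
    by_cases hk : KeepsTangential c P (r.x k) (r.n k) t
    · rw [(h2 hk).1, (h2 hk).2]; exact h1
    · exact absurd (h3 hk).1 ht
  · exact absurd (h.2.2 hcond).1 ht

/-- The zero step also passes the three tests, because `κvm` and `κntn` are below `1`; the tests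
thus hold whether or not `t` was reset. -/
lemma ComputesSteps.keepsTangential (h : ComputesSteps f c P r k) :
    KeepsTangential c P (r.x k) (r.n k) (r.t k) := by
  have hzero : KeepsTangential c P (r.x k) (r.n k) 0 := by
    have hd := h.1.model_decrease
    have h0 : 0 ≤ 1 / 2 * r.lamv k * ‖r.n k‖ ^ 2 := by
      have := h.1.lam_nonneg; positivity
    refine ⟨?_, ?_, ?_⟩
    · rw [add_zero]; nlinarith [P.κvm_mem.2]
    · rw [add_zero]; nlinarith [P.κntn_mem.2, norm_nonneg (r.n k)]
    · rw [map_zero, norm_zero]; have := P.κht_pos; positivity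
  by_cases hcond : ‖r.n k‖ ≤ P.κn * r.δs P k ∧
      ‖gp f c (r.x k) (r.H k) (r.n k)‖ ≥ P.κp * ‖gv c (r.x k)‖
  · obtain ⟨t, lam, h1, h2, h3⟩ := h.2.1 hcond
    by_cases hk : KeepsTangential c P (r.x k) (r.n k) t
    · rwa [(h2 hk).1]
    · rwa [(h3 hk).1]
  · rwa [(h.2.2 hcond).1]

lemma ComputesSteps.norm_s_le (h : ComputesSteps f c P r k) : ‖r.s k‖ ≤ P.κδ * r.δv k := by
  by_cases ht : r.t k = 0
  · rw [Iterates.s, ht, add_zero]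
    nlinarith [h.1.feasible, P.one_lt_κδ, norm_nonneg (r.n k)]
  · exact (h.isTangentialStep ht).feasible.trans (min_le_left _ _)

lemma ComputesSteps.norm_n_le (h : ComputesSteps f c P r k) :
    P.κntn * ‖r.n k‖ ≤ ‖r.s k‖ := h.keepsTangential.2.1

lemma ComputesSteps.norm_s_pos (h : ComputesSteps f c P r k) (hg : gv c (r.x k) ≠ 0) :
    0 < ‖r.s k‖ :=
  (mul_pos P.κntn_mem.1 (norm_pos_iff.2 (h.1.ne_zero hg))).trans_le h.norm_n_le

/-- A multiplier that is large relative to the normal step forces a sufficient decrease of `v`. -/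
lemma lamv_div_lt_of_rhov_lt (hc : ContDiff ℝ 2 c) (h : ComputesSteps f c P r k)
    (hg : gv c (r.x k) ≠ 0) {L : ℝ} (hL0 : 0 ≤ L)
    (hL : ∀ y ∈ segment ℝ (r.x k) (r.x k + r.s k), ∀ z ∈ segment ℝ (r.x k) (r.x k + r.s k),
      ‖Hv c y - Hv c z‖ ≤ L * ‖y - z‖) (hρ : rhov c r k < P.κρ) :
    r.lamv k / ‖r.n k‖ < (L + 2 * P.κρ) * P.κδ ^ 3 / P.κvm := by
  have hn := norm_pos_iff.2 (h.1.ne_zero hg)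
  have hs := h.norm_s_pos hg
  have hκ := P.κvm_mem.1
  have hκρ := P.κρ_mem.1
  have hκδ : 0 < P.κδ := zero_lt_one.trans P.one_lt_κδ
  by_contra! hge
  have hpos : 0 < r.lamv k / ‖r.n k‖ := lt_of_lt_of_le (by positivity) hge
  have hlam : 0 < r.lamv k := by
    rcases h.1.lam_nonneg.eq_or_lt with h0 | h0
    · rw [← h0, zero_div] at hpos; exact absurd hpos (lt_irrefl _)
    · exact h0
  -- A positive multiplier makes the constraint active, so the radius may be replaced by `‖n‖`.
  have hle : ‖r.s k‖ ≤ P.κδ * ‖r.n k‖ := by rw [h.1.norm_eq hlam]; exact h.norm_s_le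
  rw [div_le_iff₀ hκ, div_mul_eq_mul_div, le_div_iff₀ hn] at hge
  have hT := image_add_le_taylor (contDiff_infeas hc) hL0 hL
  have hkeep := h.keepsTangential.1
  change _ - mv c (r.x k) (r.s k) ≥ _ at hkeep
  have hdec := mul_le_mul_of_nonneg_left h.1.model_decrease hκ.le
  have hmv : mv c (r.x k) 0 - mv c (r.x k) (r.s k) =
      -⟪gradient (infeas c) (r.x k), r.s k⟫_ℝ -
        1 / 2 * ⟪r.s k, hessian (infeas c) (r.x k) (r.s k)⟫_ℝ := by
    simp only [mv, gv, Hv, inner_zero_right, map_zero]; ring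
  have hcube : ‖r.s k‖ ^ 3 ≤ P.κδ ^ 3 * ‖r.n k‖ ^ 3 := by
    rw [← mul_pow]; gcongr
  rw [rhov, div_lt_iff₀ (by positivity)] at hρ
  have h5 : (L + 2 * P.κρ) * ‖r.s k‖ ^ 3 ≤ P.κvm * r.lamv k * ‖r.n k‖ ^ 2 := by
    calc (L + 2 * P.κρ) * ‖r.s k‖ ^ 3 ≤ (L + 2 * P.κρ) * (P.κδ ^ 3 * ‖r.n k‖ ^ 3) := by gcongr
      _ = (L + 2 * P.κρ) * P.κδ ^ 3 * ‖r.n k‖ * ‖r.n k‖ ^ 2 := by ring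
      _ ≤ r.lamv k * P.κvm * ‖r.n k‖ ^ 2 := by gcongr
      _ = _ := by ring
  -- The model decrease is at least `(L / 2 + κρ)‖s‖³`, which covers the Taylor remainder `L / 3 *
  -- ‖s‖ ^ 3` and leaves `κρ‖s‖³`.
  have hLs : 0 ≤ L * ‖r.s k‖ ^ 3 := by positivity
  linarith

/-- A large tangential multiplier forces a sufficient decrease of `f`. -/
lemma lamf_lt_of_rhof_lt (hf : ContDiff ℝ 2 f) (h : ComputesSteps f c P r k)
    (hg : gv c (r.x k) ≠ 0) (hH : IsSelfAdjoint (r.H k)) (hF : IsFIteration f c P r k)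
    {L : ℝ} (hL0 : 0 ≤ L)
    (hL : ∀ y ∈ segment ℝ (r.x k) (r.x k + r.s k), ∀ z ∈ segment ℝ (r.x k) (r.x k + r.s k),
      ‖hessian f y - hessian f z‖ ≤ L * ‖y - z‖) (hρ : rhof f r k < P.κρ) :
    r.lamf k * (P.κfm * P.κst ^ 2 * (1 - P.κntt)) < (P.κhs + L + 2 * P.κρ) * ‖r.s k‖ := by
  obtain ⟨⟨ht0, ht⟩, hfm, -, hnt, -, hhs⟩ := hF
  have hs := h.norm_s_pos hg
  have hts := h.isTangentialStep ht0
  have hd := mul_le_mul_of_nonneg_left (hts.model_decrease hH hnt) P.κfm_mem.1.le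
  change _ ≤ P.κfm * (_ - mf f (r.x k) (r.H k) (r.s k)) at hd
  have hT := image_add_le_taylor hf hL0 hL
  have hmf : mf f (r.x k) (r.H k) 0 - mf f (r.x k) (r.H k) (r.s k) =
      -⟪gradient f (r.x k), r.s k⟫_ℝ - 1 / 2 * ⟪r.s k, r.H k (r.s k)⟫_ℝ := by
    simp only [mf, inner_zero_right, map_zero]; ring
  have hHs : ⟪r.s k, hessian f (r.x k) (r.s k)⟫_ℝ - ⟪r.s k, r.H k (r.s k)⟫_ℝ ≤
      P.κhs * ‖r.s k‖ ^ 3 := by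
    have h1 := real_inner_le_norm (r.s k) (-((r.H k - hessian f (r.x k)) (r.s k)))
    rw [norm_neg] at h1
    have h2 := mul_le_mul_of_nonneg_left hhs hs.le
    simp only [inner_neg_right, sub_apply, inner_sub_right] at h1 h2
    linarith
  rw [rhof, div_lt_iff₀ (by positivity)] at hρ
  have hκ := P.κntt_mem.2
  have hκ0 := P.κfm_mem.1
  have hκ1 := P.κst_mem.1
  have hlam := hts.lam_nonneg
  have hκ' : 0 ≤ 1 - P.κntt := by linarith
  have ht2 : r.lamf k * (P.κfm * P.κst ^ 2 * (1 - P.κntt)) * ‖r.s k‖ ^ 2 ≤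
      r.lamf k * P.κfm * (1 - P.κntt) * ‖r.t k‖ ^ 2 := by
    calc _ = r.lamf k * P.κfm * (1 - P.κntt) * (P.κst * ‖r.s k‖) ^ 2 := by ring
      _ ≤ _ := by gcongr
  have hLs : 0 ≤ L * ‖r.s k‖ ^ 3 := by positivity
  refine lt_of_mul_lt_mul_right ?_ (sq_nonneg ‖r.s k‖)
  linarith

/-- After a step with `λᵛ ≤ σᵛ‖n‖` the infeasibility gradient is quadratically small. -/
lemma norm_gv_add_le (hc : ContDiff ℝ 2 c) (h : ComputesSteps f c P r k)
    {L : ℝ} (hL0 : 0 ≤ L)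
    (hL : ∀ y ∈ segment ℝ (r.x k) (r.x k + r.s k), ∀ z ∈ segment ℝ (r.x k) (r.x k + r.s k),
      ‖Hv c y - Hv c z‖ ≤ L * ‖y - z‖) {σ : ℝ} (hσ : 0 ≤ σ)
    (hlam : r.lamv k ≤ σ * ‖r.n k‖) :
    ‖gv c (r.x k + r.s k)‖ ≤ (L + P.κht + σ / P.κntn ^ 2) * ‖r.s k‖ ^ 2 := by
  have hκ := P.κntn_mem.1
  -- Stationarity of `n` leaves only `Hᵛt`, bounded by the third test on `t`, and `λᵛn`.
  have h1 : gv c (r.x k) + Hv c (r.x k) (r.s k) =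
      Hv c (r.x k) (r.t k) - r.lamv k • r.n k := by
    have := h.1.dual
    rw [Iterates.s, map_add, ← sub_eq_zero, ← this]; abel
  have h2 := norm_gradient_add_le (contDiff_infeas hc) hL0 hL
  change ‖gv c (r.x k + r.s k)‖ ≤ ‖gv c (r.x k) + Hv c (r.x k) (r.s k)‖ + _ at h2
  rw [h1] at h2
  have h3 := norm_sub_le (Hv c (r.x k) (r.t k)) (r.lamv k • r.n k)
  have h4 : ‖Hv c (r.x k) (r.t k)‖ ≤ P.κht * ‖r.s k‖ ^ 2 := h.keepsTangential.2.2
  rw [norm_smul, Real.norm_of_nonneg h.1.lam_nonneg] at h3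
  have h5 : r.lamv k * ‖r.n k‖ ≤ σ / P.κntn ^ 2 * ‖r.s k‖ ^ 2 := by
    calc r.lamv k * ‖r.n k‖ ≤ σ * ‖r.n k‖ * ‖r.n k‖ := by gcongr
      _ = σ / P.κntn ^ 2 * (P.κntn * ‖r.n k‖) ^ 2 := by field_simp
      _ ≤ _ := by gcongr; exact h.norm_n_le
  linarith

lemma VContract.δv_le (hc : ContDiff ℝ 2 c) (hg : gv c (r.x k) ≠ 0) (h : VContract c P r k)
    (hn : IsNormalStep c (r.x k) (r.δv k) (r.n k) (r.lamv k)) : r.δv (k + 1) ≤ ‖r.n k‖ := by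
  have hR := hn.isRegularizedSolution
  have hσg : 0 < √(P.σlo * ‖gv c (r.x k)‖) :=
    Real.sqrt_pos.2 (mul_pos P.σlo_pos (norm_pos_iff.2 hg))
  by_cases hcase : r.lamv k < P.σlo * ‖r.n k‖
  · obtain ⟨n₁, h1, h2, h3⟩ := h.1 hcase
    by_cases hhi : (r.lamv k + √(P.σlo * ‖gv c (r.x k)‖)) / ‖n₁‖ ≤ P.σhi
    · rw [h2 hhi]
      exact hR.norm_le (h1.isRegularizedSolution hc hR (by linarith)) trivial (by linarith)
    · obtain ⟨lam, n₂, hlam, hs, -, -, hδ⟩ := h3 hhi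
      rw [hδ]
      exact hR.norm_le (hs.isRegularizedSolution hc hR hlam.1.le) trivial hlam.1
  · obtain ⟨n₁, h1, h2, h3⟩ := h.2 hcase
    have hpos : 0 < r.lamv k :=
      (mul_pos P.σlo_pos (norm_pos_iff.2 (hn.ne_zero hg))).trans_le (not_lt.1 hcase)
    have hlt : r.lamv k < P.γl * r.lamv k := by nlinarith [P.one_lt_γl]
    by_cases hγ : P.γc * ‖r.n k‖ ≤ ‖n₁‖
    · rw [h2 hγ]
      exact hR.norm_le (h1.isRegularizedSolution hc hR hlt.le) trivial hlt
    · rw [h3 hγ]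
      nlinarith [P.γc_mem.2, norm_nonneg (r.n k)]

/-- The effect of a contraction on the ratio `λᵛ / ‖n‖`. -/
lemma VContract.ratio (hc : ContDiff ℝ 2 c) (hg : gv c (r.x k) ≠ 0) (h : VContract c P r k)
    (hn : IsNormalStep c (r.x k) (r.δv k) (r.n k) (r.lamv k))
    (hn' : IsNormalStep c (r.x k) (r.δv (k + 1)) (r.n (k + 1)) (r.lamv (k + 1))) :
    P.σlo ≤ r.lamv (k + 1) / ‖r.n (k + 1)‖ ∧
    (P.σlo ≤ r.lamv k / ‖r.n k‖ →
      min P.γl P.γc⁻¹ * (r.lamv k / ‖r.n k‖) ≤ r.lamv (k + 1) / ‖r.n (k + 1)‖) ∧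
    r.lamv (k + 1) / ‖r.n (k + 1)‖ ≤ max P.σhi (P.γl / P.γc * (r.lamv k / ‖r.n k‖)) := by
  have hR := hn.isRegularizedSolution
  have hg' := norm_pos_iff.2 hg
  have hnpos := norm_pos_iff.2 (hn.ne_zero hg)
  have hσ := P.σlo_pos
  have hσg : 0 < √(P.σlo * ‖gv c (r.x k)‖) := Real.sqrt_pos.2 (by positivity)
  have h0 := hn.lam_nonneg
  by_cases hcase : r.lamv k < P.σlo * ‖r.n k‖
  · have hlow : ¬ P.σlo ≤ r.lamv k / ‖r.n k‖ := by
      rwa [not_le, div_lt_iff₀ hnpos]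
    obtain ⟨n₁, h1, h2, h3⟩ := h.1 hcase
    by_cases hhi : (r.lamv k + √(P.σlo * ‖gv c (r.x k)‖)) / ‖n₁‖ ≤ P.σhi
    · have hR₁ := h1.isRegularizedSolution hc hR (by linarith)
      obtain ⟨e1, e2⟩ := hn'.multiplier_eq hg hR₁ (by linarith) (h2 hhi)
      rw [e1, e2]
      exact ⟨le_div_norm_of_shift hσ hg h0 hR hR₁, fun h => absurd h hlow,
        hhi.trans (le_max_left _ _)⟩
    · obtain ⟨lam, n₂, hlam, hs, hlo, hhi', hδ⟩ := h3 hhi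
      obtain ⟨e1, e2⟩ := hn'.multiplier_eq hg (hs.isRegularizedSolution hc hR hlam.1.le)
        (h0.trans_lt hlam.1) hδ
      rw [e1, e2]
      exact ⟨hlo, fun h => absurd h hlow, hhi'.trans (le_max_left _ _)⟩
  · have hlow : P.σlo ≤ r.lamv k / ‖r.n k‖ := by
      rwa [le_div_iff₀ hnpos, ← not_lt]
    have hpos : 0 < r.lamv k := (mul_pos hσ hnpos).trans_le (not_lt.1 hcase)
    have hγl := P.one_lt_γl
    have hγc := P.γc_mem.1
    have hγc' := (one_lt_inv₀ hγc).2 P.γc_mem.2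
    have hlt : r.lamv k < P.γl * r.lamv k := by nlinarith
    obtain ⟨n₁, h1, h2, h3⟩ := h.2 hcase
    have hR₁ := h1.isRegularizedSolution hc hR hlt.le
    have hn₁ := norm_pos_iff.2 (hR₁.ne_zero hg)
    have hq : 0 < r.lamv k / ‖r.n k‖ := by positivity
    have key : min P.γl P.γc⁻¹ * (r.lamv k / ‖r.n k‖) ≤ r.lamv (k + 1) / ‖r.n (k + 1)‖ ∧
        r.lamv (k + 1) / ‖r.n (k + 1)‖ ≤ P.γl / P.γc * (r.lamv k / ‖r.n k‖) := by
      by_cases hγ : P.γc * ‖r.n k‖ ≤ ‖n₁‖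
      · obtain ⟨e1, e2⟩ := hn'.multiplier_eq hg hR₁ (hpos.trans hlt) (h2 hγ)
        rw [e1, e2]
        constructor
        · calc min P.γl P.γc⁻¹ * (r.lamv k / ‖r.n k‖) ≤ P.γl * (r.lamv k / ‖r.n k‖) := by
                gcongr; exact min_le_left _ _
            _ = P.γl * r.lamv k / ‖r.n k‖ := by ring
            _ ≤ _ := by gcongr; exact hR.norm_le hR₁ trivial hlt
        · calc P.γl * r.lamv k / ‖n₁‖ ≤ P.γl * r.lamv k / (P.γc * ‖r.n k‖) := by gcongr
            _ = _ := by rw [mul_div_mul_comm]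
      · have hδ := h3 hγ
        -- The new radius `γc‖n‖` lies between `‖n₁‖` and `‖n‖`, so the new multiplier lies between
        -- `λᵛ` and `γl λᵛ`.
        have hle1 : r.lamv k ≤ r.lamv (k + 1) := hn'.le_multiplier hg hR (by
          rw [hδ]; nlinarith [P.γc_mem.2])
        have hle2 : r.lamv (k + 1) ≤ P.γl * r.lamv k :=
          hn'.multiplier_le hg hR₁ (by positivity) (by rw [hδ]; exact (not_le.1 hγ).le)
        rw [hn'.norm_eq (hpos.trans_le hle1), hδ]
        constructor
        · calc min P.γl P.γc⁻¹ * (r.lamv k / ‖r.n k‖) ≤ P.γc⁻¹ * (r.lamv k / ‖r.n k‖) := by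
                gcongr; exact min_le_right _ _
            _ = r.lamv k / (P.γc * ‖r.n k‖) := by field_simp
            _ ≤ _ := by gcongr
        · calc _ ≤ P.γl * r.lamv k / (P.γc * ‖r.n k‖) := by gcongr
            _ = _ := by rw [mul_div_mul_comm]
    have hm : 1 ≤ min P.γl P.γc⁻¹ := le_min hγl.le hγc'.le
    exact ⟨hlow.trans ((le_mul_of_one_le_left hq.le hm).trans key.1), fun _ => key.1,
      key.2.trans (le_max_right _ _)⟩

/-- The multiplier of an F-iteration after a contraction of `δᶠ`. -/
lemma FContract.mul_norm_le_lamf (hH : IsSelfAdjoint (r.H k)) (h : FContract f c P r k)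
    (ht : IsTangentialStep f c (r.x k) (r.H k) (r.n k) (r.δs P k) (r.t k) (r.lamf k))
    (hs : 0 < ‖r.s k‖) (hcomp : ComputesSteps f c P r (k + 1))
    (hx : r.x (k + 1) = r.x k) (hn : r.n (k + 1) = r.n k) (hH' : r.H (k + 1) = r.H k)
    (hF : IsFIteration f c P r (k + 1)) :
    P.σlo * ‖r.s (k + 1)‖ ≤ r.lamf (k + 1) ∧
    ∀ q : ℝ, P.σlo ≤ q → q * ‖r.s k‖ ≤ r.lamf k →
      q * P.γc⁻¹ * ‖r.s (k + 1)‖ ≤ r.lamf (k + 1) := by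
  have hσ := P.σlo_pos
  have hγc := P.γc_mem.1
  have ht' := hcomp.isTangentialStep hF.1.1
  have hnt := hF.2.2.2.1
  rw [hx, hn, hH'] at ht'
  rw [hn] at hnt
  have hsδ : ‖r.s (k + 1)‖ ≤ r.δf (k + 1) := by
    rw [Iterates.s, hn]; exact ht'.feasible.trans (min_le_right _ _)
  by_cases hcase : r.lamf k < P.σlo * ‖r.s k‖
  · obtain ⟨lam, t₁, hlam, hsol, hlo, hδ⟩ := h.1 hcase
    have hpos : 0 < ‖r.n k + t₁‖ := by
      by_contra! hle
      -- A zero denominator would make the quotient `0`, below `σlo`.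
      rw [le_antisymm hle (norm_nonneg _), div_zero] at hlo
      linarith
    have hmul : lam ≤ r.lamf (k + 1) := ht.le_multiplier hH ht' hsol hlam
      ((min_le_right _ _).trans hδ.le) hF.1.1 P.κntt_mem.2 hnt
    rw [le_div_iff₀ hpos, ← hδ] at hlo
    refine ⟨?_, fun q hq hqs => ?_⟩
    · exact ((mul_le_mul_of_nonneg_left hsδ hσ.le).trans hlo).trans hmul
    -- Vacuous: here `λᶠ < σlo‖s‖ ≤ q‖s‖`.
    · nlinarith
  · have hδ := h.2 hcase
    have hmul : r.lamf k ≤ r.lamf (k + 1) := ht.multiplier_mono ht' (by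
      refine (min_le_right _ _).trans_lt ?_
      rw [hδ]
      change P.γc * ‖r.s k‖ < ‖r.s k‖
      nlinarith [P.γc_mem.2])
    have key : ∀ q : ℝ, P.σlo ≤ q → q * ‖r.s k‖ ≤ r.lamf k →
        q * P.γc⁻¹ * ‖r.s (k + 1)‖ ≤ r.lamf (k + 1) := fun q hq hqs => by
      have hq0 := hσ.trans_le hq
      calc q * P.γc⁻¹ * ‖r.s (k + 1)‖ ≤ q * P.γc⁻¹ * (P.γc * ‖r.s k‖) := by
            gcongr; exact hsδ.trans_eq hδ
        _ = q * ‖r.s k‖ := by field_simp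
        _ ≤ _ := hqs.trans hmul
    refine ⟨le_trans ?_ (key P.σlo le_rfl (not_lt.1 hcase)), key⟩
    gcongr
    exact le_mul_of_one_le_right hσ.le ((one_le_inv₀ hγc).2 P.γc_mem.2.le)

end Steps


/-! ### Evolution of `σᵛ`, of the funnel and of the radii along a run. -/

section Run

variable {N M : ℕ} {f : Vec N → ℝ} {c : Vec N → Vec M} {P : Params} {r : Iterates N} {k : ℕ}
  {ε LHv LHf ζ : ℝ}

lemma gv_ne_zero_of_mem_activeSet (hε : 0 < ε) (hk : k ∈ activeSet c r ε) : gv c (r.x k) ≠ 0 :=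
  norm_pos_iff.1 (hε.trans (hk k le_rfl))

lemma mem_activeSet_of_succ (hk : k + 1 ∈ activeSet c r ε) : k ∈ activeSet c r ε :=
  fun j hj => hk j (hj.trans k.le_succ)

lemma not_VAccepts_of_lt (hρ : rhov c r k < P.κρ) : ¬ VAccepts c P r k :=
  fun h => hρ.not_ge h.1

namespace IsRun

lemma isNormalStep_succ (h : IsRun f c P r ε) (hk : k + 1 ∈ activeSet c r ε)
    (hx : r.x (k + 1) = r.x k) :
    IsNormalStep c (r.x k) (r.δv (k + 1)) (r.n (k + 1)) (r.lamv (k + 1)) :=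
  hx ▸ (h.steps _ hk).1

lemma contraction (h : IsRun f c P r ε) (hk : k ∈ activeSet c r ε)
    (hV : ¬ IsFIteration f c P r k) (hρ : rhov c r k < P.κρ) :
    r.x (k + 1) = r.x k ∧ VContract c P r k :=
  ⟨((h.v_iter k hk hV).2.1 (not_VAccepts_of_lt hρ)).1,
    (h.v_iter k hk hV).2.2.1 (not_VAccepts_of_lt hρ) hρ⟩

lemma σv_succ_of_not_contraction (h : IsRun f c P r ε) (hk : k + 1 ∈ activeSet c r ε)
    (hV : ¬ (¬ IsFIteration f c P r k ∧ rhov c r k < P.κρ)) : r.σv (k + 1) = r.σv k := by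
  by_cases hF : IsFIteration f c P r k
  · exact (h.sigma k hk).1 hF
  · exact ((h.sigma k hk).2 hF).2 fun hρ => hV ⟨hF, hρ⟩

lemma σv_succ_of_contraction (h : IsRun f c P r ε) (hk : k + 1 ∈ activeSet c r ε)
    (hV : ¬ IsFIteration f c P r k) (hρ : rhov c r k < P.κρ) :
    r.σv (k + 1) = max (r.σv k) (r.lamv (k + 1) / ‖r.n (k + 1)‖) :=
  ((h.sigma k hk).2 hV).1 hρ

lemma σv_le_succ (h : IsRun f c P r ε) (hk : k + 1 ∈ activeSet c r ε) :
    r.σv k ≤ r.σv (k + 1) := by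
  by_cases hV : ¬ IsFIteration f c P r k ∧ rhov c r k < P.κρ
  · rw [h.σv_succ_of_contraction hk hV.1 hV.2]; exact le_max_left _ _
  · exact (h.σv_succ_of_not_contraction hk hV).ge

end IsRun

/-- A bound on `σᵛ` that depends only on the parameters and on the Lipschitz constant of `Hᵛ`. -/
def sigmaBound (P : Params) (LHv : ℝ) : ℝ :=
  max P.σhi (P.γl / P.γc * ((LHv + 2 * P.κρ) * P.κδ ^ 3 / P.κvm))

lemma sigmaBound_pos (P : Params) (LHv : ℝ) : 0 < sigmaBound P LHv :=
  (P.σlo_pos.trans_le P.σlo_le_σhi).trans_le (le_max_left _ _)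

lemma IsRun.σv_le_sigmaBound (hc : ContDiff ℝ 2 c) (hε : 0 < ε) (hL : 0 ≤ LHv)
    (h : IsRun f c P r ε) (hA : IterateAssumptions f c r ε LHv LHf ζ) :
    ∀ k ∈ activeSet c r ε, r.σv k ≤ sigmaBound P LHv := by
  intro k
  induction k with
  | zero => exact fun _ => h.σv_init.2.trans (le_max_left _ _)
  | succ k ih =>
    intro hk
    have hk0 := mem_activeSet_of_succ hk
    by_cases hV : ¬ IsFIteration f c P r k ∧ rhov c r k < P.κρ
    · rw [h.σv_succ_of_contraction hk hV.1 hV.2]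
      refine max_le (ih hk0) ?_
      have hg := gv_ne_zero_of_mem_activeSet hε hk0
      obtain ⟨hx, hcon⟩ := h.contraction hk0 hV.1 hV.2
      refine (hcon.ratio hc hg (h.steps k hk0).1 (h.isNormalStep_succ hk hx)).2.2.trans ?_
      refine max_le_max le_rfl (mul_le_mul_of_nonneg_left ?_ ?_)
      · exact (lamv_div_lt_of_rhov_lt hc (h.steps k hk0) hg hL (hA.lipschitz_Hv k hk0) hV.2).le
      · exact div_nonneg (zero_le_one.trans P.one_lt_γl.le) P.γc_mem.1.le
    · rw [h.σv_succ_of_not_contraction hk hV]; exact ih hk0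

variable (f c P r) in
/-- The trial point of iteration `k` is accepted. -/
def Accepted (k : ℕ) : Prop :=
  (IsFIteration f c P r k ∧ P.κρ ≤ rhof f r k) ∨ (¬ IsFIteration f c P r k ∧ VAccepts c P r k)

/-- An accepted step keeps `v` inside the funnel and shrinks the funnel. -/
lemma IsRun.vmax_succ_of_accepted (h : IsRun f c P r ε) (hk : k ∈ activeSet c r ε)
    (hε : 0 < ε) (hv : infeas c (r.x k) ≤ r.vmax k) (hacc : Accepted f c P r k) :
    r.x (k + 1) = r.x k + r.s k ∧ infeas c (r.x (k + 1)) ≤ r.vmax (k + 1) ∧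
      P.κρ * (1 - P.κv2) * ‖r.s k‖ ^ 3 ≤ r.vmax k - r.vmax (k + 1) := by
  have hs : 0 < ‖r.s k‖ ^ 3 :=
    pow_pos ((h.steps k hk).norm_s_pos (gv_ne_zero_of_mem_activeSet hε hk)) 3
  have hκρs : 0 < P.κρ * ‖r.s k‖ ^ 3 := mul_pos P.κρ_mem.1 hs
  obtain ⟨hκ0, hκ1⟩ := P.κv2_mem
  rcases hacc with ⟨hF, hρ⟩ | ⟨hV, hacc⟩
  · obtain ⟨hx, hvm, -⟩ := (h.f_iter k hk hF).1 hρ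
    have hle : infeas c (r.x (k + 1)) ≤ r.vmax k - P.κρ * ‖r.s k‖ ^ 3 := hx ▸ hF.2.2.1
    refine ⟨hx, ?_, ?_⟩
    · rw [hvm]
      exact le_min (hle.trans (le_max_right _ _)) (by nlinarith)
    -- The second entry of the minimum gives a drop of at least `(1 - κv2)(vmax - v_{k+1})`, and
    -- `vmax - v_{k+1} ≥ κρ‖s‖³`.
    · have := (hvm.trans_le (min_le_right _ _))
      nlinarith
  · obtain ⟨hx, hvm, -⟩ := (h.v_iter k hk hV).1 hacc
    have hle : infeas c (r.x (k + 1)) ≤ infeas c (r.x k) - P.κρ * ‖r.s k‖ ^ 3 := by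
      have := hacc.1
      rw [rhov, le_div_iff₀ hs, ← hx] at this
      linarith
    refine ⟨hx, ?_, ?_⟩
    · rw [hvm]
      exact le_min (le_max_of_le_right (by nlinarith)) (by nlinarith)
    · have := (hvm.trans_le (min_le_right _ _))
      nlinarith

/-- The invariants of the state of the algorithm. -/
structure StateInvariant (c : Vec N → Vec M) (P : Params) (r : Iterates N) (k : ℕ) : Prop where
  σlo_le : P.σlo ≤ r.σv k
  δv_le : r.δv k ≤ r.Δv k
  Δv_le : r.Δv 0 ≤ r.Δv k
  infeas_le : infeas c (r.x k) ≤ r.vmax k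

lemma IsRun.stateInvariant (hc : ContDiff ℝ 2 c) (hε : 0 < ε) (h : IsRun f c P r ε) :
    ∀ k ∈ activeSet c r ε, StateInvariant c P r k := by
  intro k
  induction k with
  | zero =>
    exact fun _ => ⟨h.σv_init.1, h.Δv_init, le_rfl, (le_max_right _ _).trans h.vmax_init⟩
  | succ k ih =>
    intro hk
    have hk0 := mem_activeSet_of_succ hk
    have hg := gv_ne_zero_of_mem_activeSet hε hk0
    obtain ⟨h1, h2, h3, h4⟩ := ih hk0
    have hσ := h1.trans (h.σv_le_succ hk)
    by_cases hF : IsFIteration f c P r k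
    · obtain ⟨ha, hr, hδ, hΔ⟩ := h.f_iter k hk0 hF
      refine ⟨hσ, by rwa [hδ, hΔ], by rwa [hΔ], ?_⟩
      by_cases hρ : P.κρ ≤ rhof f r k
      · exact (h.vmax_succ_of_accepted hk0 hε h4 (.inl ⟨hF, hρ⟩)).2.1
      · rwa [(hr hρ).1, (hr hρ).2.1]
    · by_cases hacc : VAccepts c P r k
      · obtain ⟨-, -, hΔ, hδ⟩ := (h.v_iter k hk0 hF).1 hacc
        refine ⟨hσ, ?_, ?_, (h.vmax_succ_of_accepted hk0 hε h4 (.inr ⟨hF, hacc⟩)).2.1⟩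
        · rw [hδ]; exact min_le_left _ _
        · rw [hΔ]; exact h3.trans (le_max_left _ _)
      · obtain ⟨-, hr, hcon, hexp, -⟩ := h.v_iter k hk0 hF
        obtain ⟨hx, hv, hΔ⟩ := hr hacc
        refine ⟨hσ, ?_, by rwa [hΔ], by rwa [hx, hv]⟩
        by_cases hρ : rhov c r k < P.κρ
        · rw [hΔ]
          have hn := (h.steps k hk0).1
          exact (((hcon hacc hρ).δv_le hc hg hn).trans hn.feasible).trans h2
        · rw [hexp hacc hρ]; exact min_le_left _ _

end Run

lemma natCast_le_floor_log {m R : ℝ} (hm : 1 < m) {j : ℕ} (h : m ^ j ≤ R) :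
    (j : ℤ) ≤ ⌊1 / Real.log m * Real.log R⌋ := by
  have hlog := Real.log_pos hm
  rw [Int.le_floor, Int.cast_natCast, one_div, ← div_eq_inv_mul, le_div_iff₀ hlog, ← Real.log_pow]
  exact Real.log_le_log (by positivity) h

/-- The growth factor of `λᵛ / ‖n‖` in the contractions of `δᵛ`. -/
lemma one_lt_growth (P : Params) : 1 < min P.γl P.γc⁻¹ :=
  lt_min P.one_lt_γl ((one_lt_inv₀ P.γc_mem.1).2 P.γc_mem.2)

/-! ### Nested counting of accepted and rejected iterations. -/

section Counting

variable {N M : ℕ} {f : Vec N → ℝ} {c : Vec N → Vec M} {P : Params} {r : Iterates N} {k : ℕ}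
  {ε LHv LHf ζ σmax : ℝ}

variable (f c P r) in
/-- Bookkeeping at iteration `k`: `aσ + aΔ` accepted steps, since the last of them `b` rejected
V-iterations, and since the last of these `e` rejected F-iterations. `F - 1` bounds `e` and `B - 1`
bounds `b`; an accepted step consumes at least `dσ` or `dΔ` of `vmax`. -/
structure CountInvariant (dσ dΔ : ℝ) (B F k aσ aΔ b e : ℕ) : Prop where
  count : k ≤ (aσ + aΔ) * (B * F) + b * F + e
  budget : aσ * dσ + aΔ * dΔ ≤ r.vmax 0 - r.vmax k
  rejectedV : b = 0 ∨
    (b = 1 ∧ (r.lamv k ≤ r.σv k * ‖r.n k‖ ∨ ‖r.n k‖ = r.Δv k)) ∨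
    ∃ j, b ≤ j + 2 ∧ P.σlo * min P.γl P.γc⁻¹ ^ j ≤ r.lamv k / ‖r.n k‖ ∧
      r.lamv k / ‖r.n k‖ ≤ r.σv k
  rejectedF : e = 0 ∨ (e + 1 ≤ F ∧ ∃ j, e = j + 1 ∧
    (IsFIteration f c P r k → P.σlo * P.γc⁻¹ ^ j * ‖r.s k‖ ≤ r.lamf k))

namespace CountInvariant

variable {dσ dΔ : ℝ} {B F aσ aΔ b e : ℕ}

lemma e_lt (h : CountInvariant f c P r dσ dΔ B F k aσ aΔ b e) (hF : 0 < F) : e + 1 ≤ F := by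
  rcases h.rejectedF with h | h <;> omega

/-- Two rejected V-iterations may contribute no growth factor: an initial expansion of `δᵛ`, and the
first contraction, which only lifts the ratio to `σlo`. Each of the others multiplies it, and the
cap `σmax` limits their number. -/
lemma b_lt (h : CountInvariant f c P r dσ dΔ B F k aσ aΔ b e) (hσ : r.σv k ≤ σmax)
    (hσmax : P.σlo ≤ σmax) (hB : KCv P σmax + 2 ≤ B) : b + 1 ≤ B := by
  have hlo := P.σlo_pos
  have h0 : 0 ≤ ⌊1 / Real.log (min P.γl P.γc⁻¹) * Real.log (σmax / P.σlo)⌋ :=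
    natCast_le_floor_log (j := 0) (one_lt_growth P) (by
      rw [pow_zero]; exact (one_le_div hlo).2 hσmax)
  rw [KCv] at hB
  rcases h.rejectedV with h | ⟨h, -⟩ | ⟨j, hj, h1, h2⟩
  · omega
  · omega
  · have : (j : ℤ) ≤ ⌊1 / Real.log (min P.γl P.γc⁻¹) * Real.log (σmax / P.σlo)⌋ := by
      refine natCast_le_floor_log (one_lt_growth P) ?_
      rw [le_div_iff₀ hlo, mul_comm]
      exact (h1.trans h2).trans hσ
    omega

lemma accepted_count (h : CountInvariant f c P r dσ dΔ B F k aσ aΔ b e) (hF : 0 < F)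
    (hb : b + 1 ≤ B) : k + 1 ≤ (aσ + aΔ + 1) * (B * F) := by
  have h1 := h.count
  have h2 := h.e_lt hF
  have h3 : (b + 1) * F ≤ B * F := Nat.mul_le_mul_right F hb
  nlinarith

/-- An accepted step starts a new count of rejected steps. -/
lemma succ_of_accepted (h : CountInvariant f c P r dσ dΔ B F k aσ aΔ b e) (hF : 0 < F)
    (hb : b + 1 ≤ B) (hd : dσ ≤ r.vmax k - r.vmax (k + 1) ∨ dΔ ≤ r.vmax k - r.vmax (k + 1)) :
    ∃ aσ aΔ b e, CountInvariant f c P r dσ dΔ B F (k + 1) aσ aΔ b e := by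
  have h1 := h.accepted_count hF hb
  have h2 := h.budget
  rcases hd with hd | hd
  · refine ⟨aσ + 1, aΔ, 0, 0, by convert h1 using 1; ring, ?_, .inl rfl, .inl rfl⟩
    push_cast; linarith
  · refine ⟨aσ, aΔ + 1, 0, 0, by convert h1 using 1; ring, ?_, .inl rfl, .inl rfl⟩
    push_cast; linarith

/-- A rejected F-iteration keeps `n`, `λᵛ`, `σᵛ`, `Δᵛ`, so the record of rejected V-iterations
survives. A second consecutive one shows that the growth accumulated before it is still below the
acceptance threshold. -/
lemma succ_of_rejectedF (h : CountInvariant f c P r dσ dΔ B F k aσ aΔ b e)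
    (hf : ContDiff ℝ 2 f) (hε : 0 < ε) (hL : 0 ≤ LHf) (hF : KCf P LHf + 1 = F)
    (hrun : IsRun f c P r ε) (hA : IterateAssumptions f c r ε LHv LHf ζ)
    (hk : k + 1 ∈ activeSet c r ε) (hFit : IsFIteration f c P r k) (hρ : ¬ P.κρ ≤ rhof f r k) :
    CountInvariant f c P r dσ dΔ B F (k + 1) aσ aΔ b (e + 1) := by
  have hk0 := mem_activeSet_of_succ hk
  have hg := gv_ne_zero_of_mem_activeSet hε hk0
  have hst := hrun.steps k hk0
  have hs := hst.norm_s_pos hg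
  obtain ⟨-, hr, hδ, hΔ⟩ := hrun.f_iter k hk0 hFit
  obtain ⟨hx, hv, hcon⟩ := hr hρ
  obtain ⟨hn, hlam, hH⟩ := hrun.unchanged k hk hx hδ
  have hσ := (hrun.sigma k hk).1 hFit
  have key := hcon.mul_norm_le_lamf (hrun.H_symm k hk0) (hst.isTangentialStep hFit.1.1) hs
    (hrun.steps _ hk) hx hn hH
  refine ⟨by have := h.count; omega, by rw [hv]; exact h.budget, ?_, .inr ?_⟩
  · rw [hn, hlam, hσ, hΔ]; exact h.rejectedV
  · rcases h.rejectedF with rfl | ⟨-, j, rfl, hj⟩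
    · refine ⟨?_, 0, rfl, fun hF' => by simpa using (key hF').1⟩
      have : 1 ≤ KCf P LHf := le_max_left _ _
      omega
    · have hjk := hj hFit
      have hlo := P.σlo_pos
      have hinv : 1 < P.γc⁻¹ := (one_lt_inv₀ P.γc_mem.1).2 P.γc_mem.2
      refine ⟨?_, j + 1, rfl, fun hF' => ?_⟩
      · have hlt := lamf_lt_of_rhof_lt hf hst hg (hrun.H_symm k hk0) hFit hL
          (hA.lipschitz_Hf k hk0) (not_le.1 hρ)
        have hD : 0 < P.κfm * P.κst ^ 2 * (1 - P.κntt) :=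
          mul_pos (mul_pos P.κfm_mem.1 (pow_pos P.κst_mem.1 2)) (sub_pos.2 P.κntt_mem.2)
        have hfl : (j : ℤ) ≤ ⌊1 / Real.log P.γc⁻¹ * Real.log ((P.κhs + LHf + 2 * P.κρ) /
            (P.σlo * P.κfm * P.κst ^ 2 * (1 - P.κntt)))⌋ := by
          refine natCast_le_floor_log hinv ?_
          rw [show P.σlo * P.κfm * P.κst ^ 2 * (1 - P.κntt) =
            P.σlo * (P.κfm * P.κst ^ 2 * (1 - P.κntt)) by ring, le_div_iff₀ (mul_pos hlo hD)]
          refine le_of_mul_le_mul_right ?_ hs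
          have := mul_le_mul_of_nonneg_right hjk hD.le
          linarith
        have : 2 + ⌊1 / Real.log P.γc⁻¹ * Real.log ((P.κhs + LHf + 2 * P.κρ) /
            (P.σlo * P.κfm * P.κst ^ 2 * (1 - P.κntt)))⌋ ≤ KCf P LHf := le_max_right _ _
        omega
      · rw [pow_succ, ← mul_assoc]
        exact (key hF').2 _ (le_mul_of_one_le_right hlo.le (one_le_pow₀ hinv.le)) hjk

lemma succ_of_rejectedV (h : CountInvariant f c P r dσ dΔ B F k aσ aΔ b e)
    (hc : ContDiff ℝ 2 c) (hε : 0 < ε) (hF : 0 < F) (hrun : IsRun f c P r ε)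
    (hk : k + 1 ∈ activeSet c r ε) (hV : ¬ IsFIteration f c P r k)
    (hacc : ¬ VAccepts c P r k) :
    CountInvariant f c P r dσ dΔ B F (k + 1) aσ aΔ (b + 1) 0 := by
  have hk0 := mem_activeSet_of_succ hk
  have hg := gv_ne_zero_of_mem_activeSet hε hk0
  have hst := hrun.steps k hk0
  have hn := norm_pos_iff.2 (hst.1.ne_zero hg)
  obtain ⟨hlo, hδΔ, -, -⟩ := hrun.stateInvariant hc hε k hk0
  obtain ⟨hx, hv, hΔ⟩ := (hrun.v_iter k hk0 hV).2.1 hacc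
  have hn' := hrun.isNormalStep_succ hk hx
  refine ⟨?_, by rw [hv]; exact h.budget, ?_, .inl rfl⟩
  · have := h.count
    have := h.e_lt hF
    nlinarith
  by_cases hρ : rhov c r k < P.κρ
  · obtain ⟨h1, h2, -⟩ := (hrun.contraction hk0 hV hρ).2.ratio hc hg hst.1 hn'
    have h3 : r.lamv (k + 1) / ‖r.n (k + 1)‖ ≤ r.σv (k + 1) := by
      rw [hrun.σv_succ_of_contraction hk hV hρ]; exact le_max_right _ _
    refine .inr (.inr ?_)
    rcases h.rejectedV with h | ⟨h, -⟩ | ⟨j, hj, h4, -⟩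
    · exact ⟨0, by omega, by simpa using h1, h3⟩
    · exact ⟨0, by omega, by simpa using h1, h3⟩
    · refine ⟨j + 1, by omega, ?_, h3⟩
      have hm := one_lt_growth P
      have hm0 : 0 ≤ min P.γl P.γc⁻¹ := by linarith
      have hlow := (le_mul_of_one_le_right P.σlo_pos.le (one_le_pow₀ hm.le)).trans h4
      refine le_trans ?_ (h2 hlow)
      rw [pow_succ, ← mul_assoc, mul_comm]
      gcongr
  · have hσ := hrun.σv_succ_of_not_contraction hk fun h => hρ h.2
    have hσpos := P.σlo_pos.trans_le hlo
    have hQ : ¬ (r.lamv k ≤ r.σv k * ‖r.n k‖ ∨ ‖r.n k‖ = r.Δv k) :=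
      fun hQ => hacc ⟨not_lt.1 hρ, hQ⟩
    -- An expansion can only be the first rejected V-iteration: after any earlier one, `λᵛ ≤ σᵛ‖n‖`
    -- or `‖n‖ = Δᵛ` holds, and the step would be accepted.
    have hb : b = 0 := by
      rcases h.rejectedV with h | ⟨-, h⟩ | ⟨-, -, -, h⟩
      · exact h
      · exact absurd h hQ
      · exact absurd (.inl ((div_le_iff₀ hn).1 h)) hQ
    refine .inr (.inl ⟨by omega, ?_⟩)
    rw [not_or, not_le] at hQ
    have hδ := (hrun.v_iter k hk0 hV).2.2.2.1 hacc hρ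
    rw [hΔ] at hδ
    rw [hσ, hΔ]
    -- The radius strictly grows, so the multiplier does not. If it stays positive, `‖n‖` becomes
    -- the new radius `min Δᵛ (λᵛ/σᵛ)`, and either value of the minimum restores the acceptance
    -- condition.
    have hlt : ‖r.n k‖ < r.δv (k + 1) := by
      rw [hδ]
      refine lt_min (lt_of_le_of_ne (hst.1.feasible.trans hδΔ) hQ.2) ?_
      rw [lt_div_iff₀ hσpos]; linarith [hQ.1]
    have hle := hn'.multiplier_le hg hst.1.isRegularizedSolution hst.1.lam_nonneg hlt.le
    rcases hn'.lam_nonneg.eq_or_lt with h0 | h0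
    · exact .inl (by rw [← h0]; positivity)
    · have heq := (hn'.norm_eq h0).trans hδ
      rcases min_choice (r.Δv k) (r.lamv k / r.σv k) with hm | hm
      · exact .inr (heq.trans hm)
      · refine .inl ?_
        rw [heq, hm, mul_div_cancel₀ _ hσpos.ne']
        exact hle

end CountInvariant

lemma rpow_le_norm_pow {X a : ℝ} (hX : 0 < X) (hε : 0 < ε) (ha : 0 ≤ a) (h : ε ≤ X * a ^ 2) :
    X ^ (-(3 / 2) : ℝ) * ε ^ (3 / 2 : ℝ) ≤ a ^ 3 := by
  have h1 : ε ^ (3 / 2 : ℝ) ≤ X ^ (3 / 2 : ℝ) * a ^ 3 := by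
    calc ε ^ (3 / 2 : ℝ) ≤ (X * a ^ 2) ^ (3 / 2 : ℝ) := by gcongr
      _ = X ^ (3 / 2 : ℝ) * (a ^ 2) ^ (3 / 2 : ℝ) := Real.mul_rpow hX.le (sq_nonneg a)
      _ = _ := by
        rw [← Real.rpow_natCast a 2, ← Real.rpow_mul ha, ← Real.rpow_natCast a 3]; norm_num
  have hX' : 0 < X ^ (3 / 2 : ℝ) := Real.rpow_pos_of_pos hX _
  rw [Real.rpow_neg hX.le, inv_mul_le_iff₀ hX']
  exact h1

/-- The constant `Hᵛ_Lip + κ_ht + σᵛ_max / κ_ntn²`. -/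
abbrev gvConst (P : Params) (LHv σmax : ℝ) : ℝ := LHv + P.κht + σmax / P.κntn ^ 2

lemma IsRun.exists_countInvariant (hf : ContDiff ℝ 2 f) (hc : ContDiff ℝ 2 c) (hε : 0 < ε)
    (hLHv : 0 < LHv) (hLHf : 0 < LHf)
    (hrun : IsRun f c P r ε) (hA : IterateAssumptions f c r ε LHv LHf ζ)
    (hσ0 : r.σv 0 ≤ σmax) (hσ : ∀ k ∈ activeSet c r ε, r.σv k ≤ σmax) {B F : ℕ}
    (hB : KCv P σmax + 2 = B) (hF : KCf P LHf + 1 = F) :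
    ∀ k ∈ activeSet c r ε, ∃ aσ aΔ b e, CountInvariant f c P r
      (P.κρ * (1 - P.κv2) * (gvConst P LHv σmax ^ (-(3 / 2) : ℝ) * ε ^ (3 / 2 : ℝ)))
      (P.κρ * (1 - P.κv2) * (P.κntn * r.Δv 0) ^ 3) B F k aσ aΔ b e := by
  have hF0 : 0 < F := by
    have : 1 ≤ KCf P LHf := le_max_left _ _
    omega
  have hσmax : P.σlo ≤ σmax := hrun.σv_init.1.trans hσ0
  have hσmax0 : 0 < σmax := P.σlo_pos.trans_le hσmax
  have hκ : 0 ≤ P.κρ * (1 - P.κv2) := mul_nonneg P.κρ_mem.1.le (sub_nonneg.2 P.κv2_mem.2.le)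
  have hX : 0 < gvConst P LHv σmax := by
    have := P.κht_pos
    have := P.κntn_mem.1
    unfold gvConst; positivity
  intro k
  induction k with
  | zero => exact fun _ => ⟨0, 0, 0, 0, by simp, by simp, .inl rfl, .inl rfl⟩
  | succ k ih =>
    intro hk
    have hk0 := mem_activeSet_of_succ hk
    obtain ⟨aσ, aΔ, b, e, h⟩ := ih hk0
    have hst := hrun.steps k hk0
    have hinv := hrun.stateInvariant hc hε k hk0
    by_cases hacc : Accepted f c P r k
    · refine h.succ_of_accepted hF0 (h.b_lt (hσ k hk0) hσmax hB.le) ?_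
      obtain ⟨hx, -, hdec⟩ := hrun.vmax_succ_of_accepted hk0 hε hinv.infeas_le hacc
      have hor : r.lamv k ≤ r.σv k * ‖r.n k‖ ∨ ‖r.n k‖ = r.Δv k := by
        rcases hacc with ⟨hFi, -⟩ | ⟨-, hV⟩
        · exact .inl hFi.2.2.2.2.1
        · exact hV.2
      rcases hor with hlam | hΔ
      · refine .inl (le_trans (mul_le_mul_of_nonneg_left ?_ hκ) hdec)
        refine rpow_le_norm_pow hX hε (norm_nonneg _) ?_
        -- The charge `dσ` needs the next iterate to be active, which is why the budget covers only
        -- acceptances before the current index.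
        have hgk := hk (k + 1) le_rfl
        rw [hx] at hgk
        refine hgk.le.trans (norm_gv_add_le hc hst hLHv.le (hA.lipschitz_Hv k hk0) hσmax0.le ?_)
        exact hlam.trans (mul_le_mul_of_nonneg_right (hσ k hk0) (norm_nonneg _))
      · refine .inr (le_trans (mul_le_mul_of_nonneg_left ?_ hκ) hdec)
        have hΔ0 : 0 ≤ r.Δv 0 := hrun.δv_init.le.trans hrun.Δv_init
        have hκn := P.κntn_mem.1.le
        refine pow_le_pow_left₀ (mul_nonneg hκn hΔ0) (le_trans ?_ hst.norm_n_le) 3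
        rw [hΔ]
        exact mul_le_mul_of_nonneg_left hinv.Δv_le hκn
    · by_cases hFi : IsFIteration f c P r k
      · exact ⟨_, _, _, _, h.succ_of_rejectedF hf hε hLHf.le hF hrun hA hk hFi
          fun hρ => hacc (.inl ⟨hFi, hρ⟩)⟩
      · exact ⟨_, _, _, _, h.succ_of_rejectedV hc hε hF0 hrun hk hFi
          fun hV => hacc (.inr ⟨hFi, hV⟩)⟩

lemma KCf_pos (P : Params) (LHf : ℝ) : 0 < KCf P LHf := zero_lt_one.trans_le (le_max_left _ _)

lemma KCv_pos {P : Params} (h : P.σlo ≤ σmax) : 0 < KCv P σmax := by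
  have := natCast_le_floor_log (j := 0) (one_lt_growth P) (R := σmax / P.σlo) (by
      rw [pow_zero]; exact (one_le_div P.σlo_pos).2 h)
  rw [KCv]; push_cast at this; linarith

/-- Since `vmax k ≥ 0`, the budget bounds `aσ` and `aΔ` separately. The `+ 1` in the first factor of
`K(ε)` accounts for the block after the last charged acceptance. -/
lemma IsRun.natCast_lt_iterBound (hf : ContDiff ℝ 2 f) (hc : ContDiff ℝ 2 c) (hε : 0 < ε)
    (hLHv : 0 < LHv) (hLHf : 0 < LHf)
    (hrun : IsRun f c P r ε) (hA : IterateAssumptions f c r ε LHv LHf ζ)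
    (hσ0 : r.σv 0 ≤ σmax) (hσ : ∀ k ∈ activeSet c r ε, r.σv k ≤ σmax)
    (hk : k ∈ activeSet c r ε) :
    (k : ℤ) < iterBound P (r.vmax 0) (r.Δv 0) LHv LHf σmax ε := by
  have hσmax : P.σlo ≤ σmax := hrun.σv_init.1.trans hσ0
  have hσmax0 : 0 < σmax := P.σlo_pos.trans_le hσmax
  have hKCf := KCf_pos P LHf
  have hKCv := KCv_pos hσmax
  obtain ⟨F, hF⟩ := Int.eq_ofNat_of_zero_le (show 0 ≤ KCf P LHf + 1 by omega)
  obtain ⟨B, hB⟩ := Int.eq_ofNat_of_zero_le (show 0 ≤ KCv P σmax + 2 by omega)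
  obtain ⟨aσ, aΔ, b, e, h⟩ :=
    hrun.exists_countInvariant hf hc hε hLHv hLHf hA hσ0 hσ hB hF k hk
  have hcount := h.accepted_count (by omega) (h.b_lt (hσ k hk) hσmax hB.le)
  have hκ : 0 < P.κρ * (1 - P.κv2) := mul_pos P.κρ_mem.1 (sub_pos.2 P.κv2_mem.2)
  have hX : 0 < gvConst P LHv σmax := by
    have := P.κht_pos
    have := P.κntn_mem.1
    unfold gvConst; positivity
  have hX' := Real.rpow_pos_of_pos hX (-(3 / 2))
  have hε' := Real.rpow_pos_of_pos hε (3 / 2)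
  have hΔ0 : 0 < r.Δv 0 := hrun.δv_init.trans_le hrun.Δv_init
  have hκn := P.κntn_mem.1
  have hvk : 0 ≤ r.vmax k :=
    (infeas_nonneg c _).trans (hrun.stateInvariant hc hε k hk).infeas_le
  have hbud := h.budget
  have hdσ : 0 < P.κρ * (1 - P.κv2) *
      (gvConst P LHv σmax ^ (-(3 / 2) : ℝ) * ε ^ (3 / 2 : ℝ)) := by positivity
  have hdΔ : 0 < P.κρ * (1 - P.κv2) * (P.κntn * r.Δv 0) ^ 3 := by positivity
  have h1 : (aσ : ℤ) ≤ Kσ P (r.vmax 0) LHv σmax ε := by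
    rw [Kσ, Int.le_floor, Int.cast_natCast, Real.rpow_neg hε.le, ← div_eq_mul_inv, div_div,
      le_div_iff₀ (by positivity)]
    have : 0 ≤ (aΔ : ℝ) * (P.κρ * (1 - P.κv2) * (P.κntn * r.Δv 0) ^ 3) := by positivity
    linarith
  have h2 : (aΔ : ℤ) ≤ KΔ P (r.vmax 0) (r.Δv 0) := by
    rw [KΔ, Int.le_floor, Int.cast_natCast, le_div_iff₀ (by
      have := P.κρ_mem.1
      have : 0 < 1 - P.κv2 := sub_pos.2 P.κv2_mem.2
      positivity)]
    have : 0 ≤ (aσ : ℝ) * (P.κρ * (1 - P.κv2) *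
      (gvConst P LHv σmax ^ (-(3 / 2) : ℝ) * ε ^ (3 / 2 : ℝ))) := by positivity
    linarith
  have h3 : (k : ℤ) + 1 ≤ ((aσ : ℤ) + aΔ + 1) * (B * F) := by exact_mod_cast hcount
  rw [iterBound, hB, hF, mul_assoc]
  have h4 : ((aσ : ℤ) + aΔ + 1) * (B * F) ≤
      (Kσ P (r.vmax 0) LHv σmax ε + KΔ P (r.vmax 0) (r.Δv 0) + 1) * (B * F) := by gcongr
  exact (Int.lt_of_add_one_le h3).trans_le h4

/-- Needed when no iteration is active: the cardinality is first bounded by the `toNat` of the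
integer bound. -/
lemma IsRun.iterBound_nonneg (hLHv : 0 < LHv) (hrun : IsRun f c P r ε) (hσ0 : r.σv 0 ≤ σmax)
    (hε : 0 ≤ ε) : 0 ≤ iterBound P (r.vmax 0) (r.Δv 0) LHv LHf σmax ε := by
  have hσmax : P.σlo ≤ σmax := hrun.σv_init.1.trans hσ0
  have hσmax0 : 0 < σmax := P.σlo_pos.trans_le hσmax
  have hv : 0 < r.vmax 0 := zero_lt_one.trans_le ((le_max_left _ _).trans hrun.vmax_init)
  have hΔ0 : 0 < r.Δv 0 := hrun.δv_init.trans_le hrun.Δv_init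
  have hκn := P.κntn_mem.1
  have hκρ := P.κρ_mem.1
  have hκ2 : 0 < 1 - P.κv2 := sub_pos.2 P.κv2_mem.2
  have hκht := P.κht_pos
  have h1 : 0 ≤ Kσ P (r.vmax 0) LHv σmax ε := Int.floor_nonneg.2 (by positivity)
  have h2 : 0 ≤ KΔ P (r.vmax 0) (r.Δv 0) := Int.floor_nonneg.2 (by positivity)
  have h3 := KCv_pos hσmax
  have h4 := KCf_pos P LHf
  unfold iterBound
  positivity

lemma IterateAssumptions.infeasSet_subset (hc : ContDiff ℝ 2 c) (hζ : 0 < ζ)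
    (hA : IterateAssumptions f c r ε LHv LHf ζ) : infeasSet c r ε ζ ⊆ activeSet c r ε := by
  rintro k ⟨hk, hck⟩ j hj
  rcases hj.eq_or_lt with rfl | hj
  · rw [div_lt_iff₀ hζ, mul_comm] at hck
    exact hck.trans_le
      (mul_norm_le_norm_gv hc hζ.le (hA.full_row_rank _ hk) (hA.singular_values _ hk))
  · exact hk j hj

lemma IsRun.infeasSet_ncard_le (hf : ContDiff ℝ 2 f) (hc : ContDiff ℝ 2 c) (hε : 0 < ε)
    (hLHv : 0 < LHv) (hLHf : 0 < LHf) (hζ : 0 < ζ)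
    (hrun : IsRun f c P r ε) (hA : IterateAssumptions f c r ε LHv LHf ζ)
    (hσ0 : r.σv 0 ≤ σmax) (hσ : ∀ k ∈ activeSet c r ε, r.σv k ≤ σmax) :
    (infeasSet c r ε ζ).Finite ∧
      ((infeasSet c r ε ζ).ncard : ℤ) ≤ iterBound P (r.vmax 0) (r.Δv 0) LHv LHf σmax ε := by
  have hsub : infeasSet c r ε ζ ⊆
      Iio (iterBound P (r.vmax 0) (r.Δv 0) LHv LHf σmax ε).toNat := fun k hk => by
    have := hrun.natCast_lt_iterBound hf hc hε hLHv hLHf hA hσ0 hσ (hA.infeasSet_subset hc hζ hk)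
    rw [mem_Iio]; omega
  refine ⟨(finite_Iio _).subset hsub, ?_⟩
  have h1 := ncard_le_ncard hsub (finite_Iio _)
  rw [← Finset.coe_Iio, ncard_coe_finset, Nat.card_Iio] at h1
  have h2 := hrun.iterBound_nonneg hLHv hσ0 (LHf := LHf) (ε := ε) hε.le
  omega

end Counting

/-! ### The rate `ε^(-3/2)` and the theorem. -/

lemma exists_iterBound_le_rpow (P : Params) (vmax0 Δ0 LHv LHf σmax : ℝ) {εbar : ℝ}
    (hεbar : 0 < εbar) : ∃ C : ℝ, 0 < C ∧ ∀ ε : ℝ, 0 < ε → ε < εbar →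
      (iterBound P vmax0 Δ0 LHv LHf σmax ε : ℝ) ≤ C * ε ^ (-(3 / 2) : ℝ) := by
  set A := vmax0 / (P.κρ * (1 - P.κv2) * (LHv + P.κht + σmax / P.κntn ^ 2) ^ (-(3 / 2) : ℝ))
  have hpos := Real.rpow_pos_of_pos hεbar (3 / 2)
  refine ⟨(|A| + (|(KΔ P vmax0 Δ0 : ℝ)| + 2) * εbar ^ (3 / 2 : ℝ)) *
    (|(KCv P σmax : ℝ)| + 2) * (|(KCf P LHf : ℝ)| + 1), by positivity, fun ε hε hlt => ?_⟩
  have hεr : 0 < ε ^ (-(3 / 2) : ℝ) := Real.rpow_pos_of_pos hε _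
  -- This absorbs the terms of `K(ε)` that do not depend on `ε`. Absolute values replace signs
  -- because `vmax0`, `Δ0` and `σmax` are arbitrary reals here.
  have h1 : 1 ≤ εbar ^ (3 / 2 : ℝ) * ε ^ (-(3 / 2) : ℝ) := by
    rw [Real.rpow_neg hε.le, ← div_eq_mul_inv, one_le_div (Real.rpow_pos_of_pos hε _)]
    exact Real.rpow_le_rpow hε.le hlt.le (by norm_num)
  have hK : |(Kσ P vmax0 LHv σmax ε : ℝ) + KΔ P vmax0 Δ0 + 1| ≤
      (|A| + (|(KΔ P vmax0 Δ0 : ℝ)| + 2) * εbar ^ (3 / 2 : ℝ)) * ε ^ (-(3 / 2) : ℝ) := by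
    have h2 : |(Kσ P vmax0 LHv σmax ε : ℝ)| ≤ |A| * ε ^ (-(3 / 2) : ℝ) + 1 := by
      have h0 : |A * ε ^ (-(3 / 2) : ℝ)| = |A| * ε ^ (-(3 / 2) : ℝ) := by
        rw [abs_mul, abs_of_pos hεr]
      rw [← h0]
      have h3 : (Kσ P vmax0 LHv σmax ε : ℝ) ≤ A * ε ^ (-(3 / 2) : ℝ) := Int.floor_le _
      have h4 : A * ε ^ (-(3 / 2) : ℝ) < (Kσ P vmax0 LHv σmax ε : ℝ) + 1 := Int.lt_floor_add_one _
      rw [abs_le]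
      constructor
      · linarith [neg_abs_le (A * ε ^ (-(3 / 2) : ℝ))]
      · linarith [le_abs_self (A * ε ^ (-(3 / 2) : ℝ))]
    have h5 : |(Kσ P vmax0 LHv σmax ε : ℝ) + KΔ P vmax0 Δ0 + 1| ≤
        |(Kσ P vmax0 LHv σmax ε : ℝ)| + |(KΔ P vmax0 Δ0 : ℝ)| + 1 :=
      (abs_add_three _ _ _).trans_eq (by rw [abs_one])
    have h6 := mul_le_mul_of_nonneg_left h1
      (add_nonneg (abs_nonneg (KΔ P vmax0 Δ0 : ℝ)) zero_le_two)
    linarith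
  have hv : |(KCv P σmax : ℝ) + 2| ≤ |(KCv P σmax : ℝ)| + 2 :=
    (abs_add_le _ _).trans_eq (by rw [abs_two])
  have hf : |(KCf P LHf : ℝ) + 1| ≤ |(KCf P LHf : ℝ)| + 1 :=
    (abs_add_le _ _).trans_eq (by rw [abs_one])
  rw [iterBound]
  push_cast
  refine (le_abs_self _).trans ?_
  rw [abs_mul, abs_mul]
  calc _ ≤ (|A| + (|(KΔ P vmax0 Δ0 : ℝ)| + 2) * εbar ^ (3 / 2 : ℝ)) * ε ^ (-(3 / 2) : ℝ) *
        (|(KCv P σmax : ℝ)| + 2) * (|(KCf P LHf : ℝ)| + 1) := by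
        have := (abs_nonneg _).trans hK
        gcongr
    _ = _ := by ring

end TrustFunnel

end

theorem mainTheorem3 {N M : ℕ} (f : TrustFunnel.Vec N → ℝ)
    (c : TrustFunnel.Vec N → TrustFunnel.Vec M) (hf : ContDiff ℝ 2 f) (hc : ContDiff ℝ 2 c)
    (P : TrustFunnel.Params) (vmax0 Δ0 LHv LHf ζ : ℝ)
    (hLHv : 0 < LHv) (hLHf : 0 < LHf) (hζ : 0 < ζ) :
    -- the sequences `σᵛ` are bounded on the active iterations, uniformly in the tolerance
    (∃ σmax : ℝ, 0 < σmax ∧ ∀ ε : ℝ, 0 < ε → ∀ r : TrustFunnel.Iterates N,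
      TrustFunnel.IsRun f c P r ε → TrustFunnel.IterateAssumptions f c r ε LHv LHf ζ →
      r.σv 0 ≤ σmax ∧ ∀ k ∈ TrustFunnel.activeSet c r ε, r.σv k ≤ σmax) ∧
    -- the explicit bound, for every such bound `σmax`
    (∀ ε : ℝ, 0 < ε → ∀ r : TrustFunnel.Iterates N,
      TrustFunnel.IsRun f c P r ε → TrustFunnel.IterateAssumptions f c r ε LHv LHf ζ →
      r.vmax 0 = vmax0 → r.Δv 0 = Δ0 →
      ∀ σmax : ℝ, r.σv 0 ≤ σmax → (∀ k ∈ TrustFunnel.activeSet c r ε, r.σv k ≤ σmax) →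
        (TrustFunnel.infeasSet c r ε ζ).Finite ∧
        ((TrustFunnel.infeasSet c r ε ζ).ncard : ℤ) ≤
          TrustFunnel.iterBound P vmax0 Δ0 LHv LHf σmax ε) ∧
    -- the rate
    (∀ εbar : ℝ, 0 < εbar → ∃ C : ℝ, 0 < C ∧ ∀ ε : ℝ, 0 < ε → ε < εbar →
      ∀ r : TrustFunnel.Iterates N,
      TrustFunnel.IsRun f c P r ε → TrustFunnel.IterateAssumptions f c r ε LHv LHf ζ →
      r.vmax 0 = vmax0 → r.Δv 0 = Δ0 →
        (TrustFunnel.infeasSet c r ε ζ).Finite ∧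
        ((TrustFunnel.infeasSet c r ε ζ).ncard : ℝ) ≤ C * ε ^ (-(3 / 2) : ℝ)) := by
  have hσb := TrustFunnel.sigmaBound_pos P LHv
  refine ⟨⟨TrustFunnel.sigmaBound P LHv, hσb, fun ε hε r hrun hA => ?_⟩, ?_, fun εbar hεbar => ?_⟩
  · exact ⟨hrun.σv_init.2.trans (le_max_left _ _), hrun.σv_le_sigmaBound hc hε hLHv.le hA⟩
  · rintro ε hε r hrun hA rfl rfl σmax hσ0 hσ
    exact hrun.infeasSet_ncard_le hf hc hε hLHv hLHf hζ hA hσ0 hσ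
  -- The uniform bound on `σᵛ` serves as `σmax`, so that `C` depends neither on the run nor on `ε`.
  · obtain ⟨C, hC, hle⟩ := TrustFunnel.exists_iterBound_le_rpow P vmax0 Δ0 LHv LHf
      (TrustFunnel.sigmaBound P LHv) hεbar
    refine ⟨C, hC, fun ε hε hlt r hrun hA hv hΔ => ?_⟩
    obtain ⟨hfin, hcard⟩ := hrun.infeasSet_ncard_le hf hc hε hLHv hLHf hζ hA
      (σmax := TrustFunnel.sigmaBound P LHv) (hrun.σv_init.2.trans (le_max_left _ _))
      (hrun.σv_le_sigmaBound hc hε hLHv.le hA)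
    rw [hv, hΔ] at hcard
    exact ⟨hfin, le_trans (by exact_mod_cast hcard) (hle ε hε hlt)⟩
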